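/- **Notation.** For a positive integer $k$, let $\varepsilon=1/\sqrt k$, $p_a=a/k^{1/3}$ and let $\mu_a$ be the distribution on $\{0,1\}^k$ whose bits are independent and equal to $1$ with probability $p_a$ ($a=1,2,3,4$). Let $\mathcal D_1$ be the mixture that, with probability $1-\varepsilon$, sets one uniformly random bit to $1$ and all others to $0$, and with probability $\varepsilon/4$ for each $a\in\{1,2,3,4\}$ samples from $\mu_a$. Let $\mathcal D_0$ be the mixture that, with probability $1-(\varepsilon_1+\varepsilon_2+\varepsilon_3+\varepsilon_4)$, sets all bits to $0$, and with probability $\varepsilon_a$ samples from $\mu_a$, where $\varepsilon_1,\dots,\varepsilon_4$ solve the linear system $$\sum_{a=1}^4\varepsilon_a p_a=\frac{1-\varepsilon}{k}+\sum_{a=1}^4\frac{\varepsilon}{4}p_a,\qquad \sum_{a=1}^4\varepsilon_a p_a^d=\sum_{a=1}^4\frac{\varepsilon}{4}p_a^d\quad(d=2,3,4),$$ that is, $\varepsilon_a=\frac{\varepsilon}{4}+c_a(1-\varepsilon)k^{-2/3}$ with $(c_1,c_2,c_3,c_4)=(4,-3,\frac43,-\frac14)$. For $k\ge 12^6$ these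 are probability distributions. **Dictatorship test.** Given $h:\{0,1\}^{k\times R}\to\{0,1\}$: choose a uniformly random bit $b$; draw $x=(x_i^{(j)})_{i\in[k],j\in[R]}$ whose $R$ columns are independent samples of $\mathcal D_b$; independently for all $i,j$ let $y_i^{(j)}=x_i^{(j)}$ with probability $1-\frac1{k^2}$ and let $y_i^{(j)}$ be a fresh uniformly random bit with probability $\frac1{k^2}$; $h$ passes if $h(y)=b$. **Theorem (soundness).** There is an absolute constant $C$ such that the following holds for all integers $k\ge 12^6$ and $R\ge1$. Let $\tau=1/k^7$ and $$t=\frac1{\tau^2}\bigl(3\ln(1/\tau)+\ln R\bigr)+\lceil 4k^2\ln k\rceil\Bigl\lceil\frac4{\tau^2}\ln(1/\tau)\Bigr\rceil .$$ Let $w_1,\dots,w_k\in\mathbb R^R$, $\theta\in\mathbb R$, and let $h(y)=\operatorname{sgn}\bigl(\sum_{i=1}^k\langle w_i,y_i\rangle-\theta\bigr)$ be the corresponding halfspace on $\{0,1\}^{k\times R}$, where $y_i$ is the $i$-th row of $y$, and $\operatorname{sgn}(s)=1$ if $s\ge0$ and $\operatorname{sgn}(s)=0$ if $s<0$. For each $i$,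 let $B_t(w_i)\subseteq[R]$ be a set of the $\min(\lfloor t\rfloor,R)$ coordinates of $w_i$ that are largest in absolute value (ties broken arbitrarily). If the sets $B_t(w_1),\dots,B_t(w_k)$ are pairwise disjoint, then $h$ passes the dictatorship test with probability at most $\frac12+\frac Ck$. -/

import Mathlib

open scoped BigOperators

namespace DictTest

noncomputable section

/-- The real number `0` or `1` encoded by a bit. -/
def bit (b : Bool) : ℝ := if b then 1 else 0

/-- `p` is the mass function of a probability distribution on the finite set `Ω`. -/
def IsProbMass {Ω : Type*} [Fintype Ω] (p : Ω → ℝ) : Prop :=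
  (∀ x, 0 ≤ p x) ∧ ∑ x, p x = 1

/-- Mass of `x ∈ {0,1}^k` when every bit is independently set to `1` with probability `p`. -/
def iidMass (k : ℕ) (p : ℝ) (x : Fin k → Bool) : ℝ :=
  ∏ i, if x i then p else 1 - p

/-- Mass of `x ∈ {0,1}^k` when every bit is `0`. -/
def zeroMass (k : ℕ) (x : Fin k → Bool) : ℝ :=
  if x = (fun _ => false) then 1 else 0

/-- Mass of `x ∈ {0,1}^k` when one uniformly random bit is `1` and all the others are `0`. -/
def oneHotMass (k : ℕ) (x : Fin k → Bool) : ℝ :=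
  (1 / (k : ℝ)) * ∑ i, if x = (fun j => decide (j = i)) then 1 else 0

/-- The parameter `ε = 1/√k`. -/
def eps (k : ℕ) : ℝ := 1 / Real.sqrt k

/-- The bias `(a+1)/k^{1/3}`, for `a = 0, 1, 2, 3`. -/
def bias (k : ℕ) (a : Fin 4) : ℝ := ((a : ℕ) + 1 : ℝ) / (k : ℝ) ^ (1 / 3 : ℝ)

/-- The distribution `𝒟₁`: with probability `1 - ε` a uniformly random bit is `1` and the others
are `0`; with probability `ε/4` each, all bits are independent with bias `(a+1)/k^{1/3}`. -/
def D1 (k : ℕ) (x : Fin k → Bool) : ℝ :=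
  (1 - eps k) * oneHotMass k x + ∑ a : Fin 4, eps k / 4 * iidMass k (bias k a) x

/-- The coefficients `(4, -3, 4/3, -1/4)`, the solution `c` of
`∑ (a+1) c_a = 1` and `∑ (a+1)^d c_a = 0` for `d = 2, 3, 4`. -/
def coef : Fin 4 → ℝ := ![4, -3, 4 / 3, -(1 / 4)]

/-- The mixture weights `ε₁, …, ε₄` of `𝒟₀`, solved from the moment equations
(see `weights_first_moment` and `weights_higher_moments`). -/
def weight (k : ℕ) (a : Fin 4) : ℝ :=
  eps k / 4 + coef a * ((1 - eps k) / k * (k : ℝ) ^ (1 / 3 : ℝ))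

/-- The distribution `𝒟₀`: with probability `1 - (ε₁+ε₂+ε₃+ε₄)` all bits are `0`;
with probability `ε_{a+1}`, all bits are independent with bias `(a+1)/k^{1/3}`. -/
def D0 (k : ℕ) (x : Fin k → Bool) : ℝ :=
  (1 - ∑ a, weight k a) * zeroMass k x + ∑ a : Fin 4, weight k a * iidMass k (bias k a) x

/-- `𝒟_b` for a bit `b`. -/
def D (k : ℕ) (b : Bool) : (Fin k → Bool) → ℝ := if b then D1 k else D0 k

/-- Probability that a noisy bit equals `y`, given the original bit `x`: the bit is kept with
probability `1 - 1/k²`, and replaced by a uniformly random bit with probability `1/k²`. -/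
def noiseMass (k : ℕ) (x y : Bool) : ℝ :=
  (1 - 1 / (k : ℝ) ^ 2) * (if y = x then 1 else 0) + 1 / (k : ℝ) ^ 2 * (1 / 2)

/-- Probability that the dictatorship test outputs the labelled example `(y, b)`: the bit `b` is
uniform, the `R` columns of `x ∈ {0,1}^{k×R}` are independent samples of `𝒟_b`, and `y` is
obtained from `x` by independent noise on each entry. -/
def testMass (k R : ℕ) (e : (Fin k → Fin R → Bool) × Bool) : ℝ :=
  1 / 2 * ∑ x : Fin k → Fin R → Bool,
    (∏ j, D k e.2 (fun i => x i j)) * ∏ i, ∏ j, noiseMass k (x i j) (e.1 i j)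

/-- Probability that `h` passes the dictatorship test, i.e. that `h y = b`. -/
def passProb (k R : ℕ) (h : (Fin k → Fin R → Bool) → Bool) : ℝ :=
  ∑ e : (Fin k → Fin R → Bool) × Bool, if h e.1 = e.2 then testMass k R e else 0

/-- The halfspace `y ↦ sgn(⟨w, y⟩ - θ)`, where `sgn s = 1` if `s ≥ 0` and `sgn s = 0` if `s < 0`. -/
def halfspace {k R : ℕ} (w : Fin k → Fin R → ℝ) (θ : ℝ) (y : Fin k → Fin R → Bool) : Bool :=
  decide (0 ≤ ∑ i, ∑ j, w i j * bit (y i j) - θ)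

/-- `τ = 1/k⁷`. -/
def tau (k : ℕ) : ℝ := 1 / (k : ℝ) ^ 7

/-- `t = (1/τ²)(3 ln(1/τ) + ln R) + ⌈4 k² ln k⌉ ⌈(4/τ²) ln(1/τ)⌉`. -/
def topSize (k R : ℕ) : ℝ :=
  1 / tau k ^ 2 * (3 * Real.log (1 / tau k) + Real.log R)
    + (⌈4 * (k : ℝ) ^ 2 * Real.log k⌉₊ : ℝ) * (⌈4 / tau k ^ 2 * Real.log (1 / tau k)⌉₊ : ℝ)

/-- `B` is a set of the `t` coordinates of `v` that are largest in absolute value: the coordinates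
in positions `1, 2, … ≤ t` when the entries are ordered by decreasing absolute value, with ties
broken in some way (all coordinates, if there are at most `t` of them). -/
def IsTopSet {R : ℕ} (t : ℝ) (v : Fin R → ℝ) (B : Finset (Fin R)) : Prop :=
  B.card = min ⌊t⌋₊ R ∧ ∀ i ∈ B, ∀ j ∉ B, |v j| ≤ |v i|

/-! Facts certifying that the above are probability distributions, and that the weights of `𝒟₀`
solve the linear system which defines them. -/

theorem weights_first_moment {k : ℕ} (hk : 0 < k) :
    ∑ a, weight k a * bias k a = (1 - eps k) / k + ∑ a, eps k / 4 * bias k a := by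
  have h : (0 : ℝ) < (k : ℝ) ^ (1 / 3 : ℝ) := Real.rpow_pos_of_pos (by exact_mod_cast hk) _
  have h2 : (0 : ℝ) < k := by exact_mod_cast hk
  simp only [weight, bias, coef, Fin.sum_univ_four]
  generalize (k : ℝ) ^ (1 / 3 : ℝ) = q at *
  simp
  field_simp
  ring

theorem weights_higher_moments {k d : ℕ} (hd : d ∈ ({2, 3, 4} : Finset ℕ)) :
    ∑ a, weight k a * bias k a ^ d = ∑ a, eps k / 4 * bias k a ^ d := by
  simp only [weight, bias, coef, Fin.sum_univ_four]
  generalize (k : ℝ) ^ (1 / 3 : ℝ) = q at *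
  simp only [Finset.mem_insert, Finset.mem_singleton] at hd
  rcases hd with rfl | rfl | rfl <;> simp <;> ring

theorem eps_bounds {k : ℕ} (hk : 12 ^ 6 ≤ k) : 0 < eps k ∧ eps k ≤ 1 / 12 ^ 3 ∧
    0 < (1 - eps k) / k * (k : ℝ) ^ (1 / 3 : ℝ) ∧
    (1 - eps k) / k * (k : ℝ) ^ (1 / 3 : ℝ) ≤ eps k / 12 := by
  have hk' : (12 ^ 6 : ℝ) ≤ k := by exact_mod_cast hk
  have hpos : (0 : ℝ) < k := by linarith [show (0 : ℝ) < 12 ^ 6 by norm_num]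
  obtain ⟨s, hs⟩ : ∃ s : ℝ, s = (k : ℝ) ^ (1 / 6 : ℝ) := ⟨_, rfl⟩
  have hs0 : 0 < s := hs ▸ Real.rpow_pos_of_pos hpos _
  have hs6 : s ^ 6 = k := by
    rw [hs, ← Real.rpow_natCast, ← Real.rpow_mul hpos.le]; norm_num
  have hs12 : 12 ≤ s := by
    refine le_of_pow_le_pow_left₀ (n := 6) (by norm_num) hs0.le ?_
    rw [hs6]; exact hk'
  have h3 : (k : ℝ) ^ (1 / 3 : ℝ) = s ^ 2 := by
    rw [hs, ← Real.rpow_natCast, ← Real.rpow_mul hpos.le]; norm_num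
  have h2 : Real.sqrt k = s ^ 3 := by
    rw [← hs6, show s ^ 6 = (s ^ 3) ^ 2 by ring, Real.sqrt_sq (by positivity)]
  have he : eps k = 1 / s ^ 3 := by rw [eps, h2]
  have he1 : eps k ≤ 1 / 12 ^ 3 := by
    rw [he]; gcongr
  have he0 : 0 < eps k := by rw [he]; positivity
  have hlt : 0 < 1 - eps k := by
    have : (1 : ℝ) / 12 ^ 3 < 1 := by norm_num
    linarith
  refine ⟨he0, he1, by positivity, ?_⟩
  rw [h3, ← hs6]
  calc (1 - eps k) / s ^ 6 * s ^ 2 ≤ 1 / s ^ 6 * s ^ 2 := by gcongr; linarith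
    _ = 1 / s ^ 3 * (1 / s) := by field_simp
    _ ≤ 1 / s ^ 3 * (1 / 12) := by gcongr
    _ = eps k / 12 := by rw [he]; ring

theorem weight_nonneg {k : ℕ} (hk : 12 ^ 6 ≤ k) (a : Fin 4) : 0 ≤ weight k a := by
  obtain ⟨h1, h2, h3, h4⟩ := eps_bounds hk
  fin_cases a <;> simp [weight, coef] <;> simp at h3 h4 <;> linarith

theorem weight_sum_le {k : ℕ} (hk : 12 ^ 6 ≤ k) : ∑ a, weight k a ≤ 2 * eps k := by
  obtain ⟨h1, h2, h3, h4⟩ := eps_bounds hk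
  simp [weight, coef, Fin.sum_univ_four] at *
  linarith

theorem bias_mem {k : ℕ} (hk : 12 ^ 6 ≤ k) (a : Fin 4) : 0 ≤ bias k a ∧ bias k a ≤ 1 := by
  have hk' : (12 ^ 6 : ℝ) ≤ k := by exact_mod_cast hk
  have h : (144 : ℝ) ≤ (k : ℝ) ^ (1 / 3 : ℝ) := by
    calc (144 : ℝ) = ((12 ^ 6 : ℝ)) ^ (1 / 3 : ℝ) := by
          rw [← Real.rpow_natCast, ← Real.rpow_mul (by norm_num)]; norm_num
      _ ≤ _ := by gcongr
  refine ⟨by unfold bias; positivity, ?_⟩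
  unfold bias
  rw [div_le_one (by linarith)]
  have : ((a : ℕ) : ℝ) ≤ 3 := by exact_mod_cast Nat.lt_succ_iff.mp a.2
  linarith

theorem iidMass_isProbMass (k : ℕ) {p : ℝ} (h0 : 0 ≤ p) (h1 : p ≤ 1) :
    IsProbMass (iidMass k p) := by
  refine ⟨fun x => Finset.prod_nonneg fun i _ => by split_ifs <;> linarith, ?_⟩
  unfold iidMass
  rw [← Fintype.prod_sum (fun (_ : Fin k) (b : Bool) => if b then p else 1 - p)]
  simp

theorem zeroMass_isProbMass (k : ℕ) : IsProbMass (zeroMass k) :=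
  ⟨fun x => by unfold zeroMass; split_ifs <;> norm_num, by simp [zeroMass]⟩

theorem oneHotMass_isProbMass {k : ℕ} (hk : 0 < k) : IsProbMass (oneHotMass k) := by
  constructor
  · intro x
    exact mul_nonneg (by positivity) (Finset.sum_nonneg fun i _ => by split_ifs <;> norm_num)
  · unfold oneHotMass
    rw [← Finset.mul_sum, Finset.sum_comm]
    simp [hk.ne']

theorem D1_isProbMass {k : ℕ} (hk : 12 ^ 6 ≤ k) : IsProbMass (D1 k) := by
  obtain ⟨h1, h2, -, -⟩ := eps_bounds hk
  have hiid := fun a => iidMass_isProbMass k (bias_mem hk a).1 (bias_mem hk a).2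
  have hone := oneHotMass_isProbMass (k := k) (lt_of_lt_of_le (by norm_num) hk)
  constructor
  · intro x
    refine add_nonneg (mul_nonneg ?_ (hone.1 x))
      (Finset.sum_nonneg fun a _ => mul_nonneg (by linarith) ((hiid a).1 x))
    have : (1 : ℝ) / 12 ^ 3 < 1 := by norm_num
    linarith
  · unfold D1
    rw [Finset.sum_add_distrib, ← Finset.mul_sum, hone.2, Finset.sum_comm]
    simp_rw [← Finset.mul_sum, (hiid _).2]
    simp

theorem D0_isProbMass {k : ℕ} (hk : 12 ^ 6 ≤ k) : IsProbMass (D0 k) := by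
  obtain ⟨h1, h2, -, -⟩ := eps_bounds hk
  have hiid := fun a => iidMass_isProbMass k (bias_mem hk a).1 (bias_mem hk a).2
  have hz := zeroMass_isProbMass k
  have hw := weight_sum_le hk
  constructor
  · intro x
    refine add_nonneg (mul_nonneg ?_ (hz.1 x))
      (Finset.sum_nonneg fun a _ => mul_nonneg (weight_nonneg hk a) ((hiid a).1 x))
    have : (2 : ℝ) * (1 / 12 ^ 3) < 1 := by norm_num
    linarith
  · unfold D0
    rw [Finset.sum_add_distrib, ← Finset.mul_sum, hz.2, Finset.sum_comm]
    simp_rw [← Finset.mul_sum, (hiid _).2]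
    simp

theorem testMass_isProbMass {k : ℕ} (R : ℕ) (hk : 12 ^ 6 ≤ k) : IsProbMass (testMass k R) := by
  have hD : ∀ b, IsProbMass (D k b) := by
    intro b; cases b
    · simpa [D] using D0_isProbMass hk
    · simpa [D] using D1_isProbMass hk
  have hk1 : (1 : ℝ) ≤ k := by exact_mod_cast le_trans (by norm_num) hk
  have hγ : 1 / (k : ℝ) ^ 2 ≤ 1 := by
    rw [div_le_one (by positivity)]; exact one_le_pow₀ hk1
  have hn : ∀ x, IsProbMass (noiseMass k x) := by
    intro x
    constructor
    · intro y
      refine add_nonneg (mul_nonneg (by linarith) (by split_ifs <;> norm_num)) (by positivity)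
    · cases x <;> simp [noiseMass] <;> ring
  constructor
  · intro e
    exact mul_nonneg (by norm_num) (Finset.sum_nonneg fun x _ => mul_nonneg
      (Finset.prod_nonneg fun j _ => (hD _).1 _)
      (Finset.prod_nonneg fun i _ => Finset.prod_nonneg fun j _ => (hn _).1 _))
  · have hnoise : ∀ x : Fin k → Fin R → Bool,
        ∑ y : Fin k → Fin R → Bool, ∏ i, ∏ j, noiseMass k (x i j) (y i j) = 1 := by
      intro x
      rw [← Fintype.prod_sum
        (fun (i : Fin k) (r : Fin R → Bool) => ∏ j, noiseMass k (x i j) (r j))]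
      refine Finset.prod_eq_one fun i _ => ?_
      rw [← Fintype.prod_sum (fun (j : Fin R) (c : Bool) => noiseMass k (x i j) c)]
      exact Finset.prod_eq_one fun j _ => (hn _).2
    have hcol : ∀ b, ∑ x : Fin k → Fin R → Bool, ∏ j, D k b (fun i => x i j) = 1 := by
      intro b
      rw [← (Equiv.piComm (fun (_ : Fin R) (_ : Fin k) => Bool)).sum_comp]
      simp only [Equiv.piComm_apply, Function.swap]
      rw [← Fintype.prod_sum (fun (_ : Fin R) (c : Fin k → Bool) => D k b c)]
      exact Finset.prod_eq_one fun j _ => (hD b).2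
    rw [Fintype.sum_prod_type_right]
    simp only [testMass]
    simp_rw [← Finset.mul_sum]
    have : ∀ b, ∑ y : Fin k → Fin R → Bool, ∑ x : Fin k → Fin R → Bool,
        (∏ j, D k b (fun i => x i j)) * ∏ i, ∏ j, noiseMass k (x i j) (y i j) = 1 := by
      intro b
      rw [Finset.sum_comm]
      simp_rw [← Finset.mul_sum, hnoise, mul_one, hcol]
    simp [this]

end

end DictTest

open scoped BigOperators

namespace DictTest

noncomputable section

/-! ### Sums of independent finitely supported variables -/

/-- Expectation of `φ (c + ∑ j, s j (y j))` when the `y j` are independent with masses `q j`. -/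
def prodExp {Z : Type*} [Fintype Z] {n : ℕ} (q s : Fin n → Z → ℝ) (φ : ℝ → ℝ) (c : ℝ) : ℝ :=
  ∑ y : Fin n → Z, (∏ j, q j (y j)) * φ (c + ∑ j, s j (y j))

theorem prodExp_zero {Z : Type*} [Fintype Z] (q s : Fin 0 → Z → ℝ) (φ : ℝ → ℝ) (c : ℝ) :
    prodExp q s φ c = φ c := by
  simp [prodExp]

theorem prodExp_succ {Z : Type*} [Fintype Z] {n : ℕ} (q s : Fin (n + 1) → Z → ℝ) (φ : ℝ → ℝ)
    (c : ℝ) :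
    prodExp q s φ c =
      ∑ z, q 0 z * prodExp (fun j => q j.succ) (fun j => s j.succ) φ (c + s 0 z) := by
  unfold prodExp
  rw [← (Fin.consEquiv (fun _ : Fin (n + 1) => Z)).sum_comp, Fintype.sum_prod_type]
  refine Finset.sum_congr rfl fun z _ => ?_
  rw [Finset.mul_sum]
  refine Finset.sum_congr rfl fun y _ => ?_
  simp [Fin.consEquiv, Fin.prod_univ_succ, Fin.sum_univ_succ, mul_assoc, add_assoc]

/-- `φ` is approximated around every point by a cubic polynomial, with error `M u⁴` at
distance `u`. -/
def HasCubicApprox (M : ℝ) (φ : ℝ → ℝ) : Prop :=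
  ∃ a : ℕ → ℝ → ℝ, ∀ x u, |φ (x + u) - ∑ d ∈ Finset.range 4, a d x * u ^ d| ≤ M * u ^ 4

theorem HasCubicApprox.average {Z : Type*} [Fintype Z] {M : ℝ} {φ : Z → ℝ → ℝ}
    (hφ : ∀ z, HasCubicApprox M (φ z)) {q : Z → ℝ} (hq : IsProbMass q) (s : Z → ℝ) :
    HasCubicApprox M (fun c => ∑ z, q z * φ z (c + s z)) := by
  choose a ha using hφ
  refine ⟨fun d x => ∑ z, q z * a z d (x + s z), fun x u => ?_⟩
  have h1 : (∑ z, q z * φ z (x + u + s z)) - ∑ d ∈ Finset.range 4,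
      (∑ z, q z * a z d (x + s z)) * u ^ d
      = ∑ z, q z * (φ z (x + s z + u) - ∑ d ∈ Finset.range 4, a z d (x + s z) * u ^ d) := by
    simp_rw [mul_sub, Finset.sum_sub_distrib, Finset.mul_sum, Finset.sum_mul]
    rw [Finset.sum_comm]
    congr 1
    · refine Finset.sum_congr rfl fun z _ => by rw [add_right_comm]
    · refine Finset.sum_congr rfl fun z _ => Finset.sum_congr rfl fun d _ => by ring
  rw [h1]
  calc _ ≤ ∑ z, |q z * (φ z (x + s z + u) - ∑ d ∈ Finset.range 4, a z d (x + s z) * u ^ d)| :=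
        Finset.abs_sum_le_sum_abs _ _
    _ ≤ ∑ z, q z * (M * u ^ 4) := by
        refine Finset.sum_le_sum fun z _ => ?_
        rw [abs_mul, abs_of_nonneg (hq.1 z)]
        exact mul_le_mul_of_nonneg_left (ha z _ _) (hq.1 z)
    _ = M * u ^ 4 := by rw [← Finset.sum_mul, hq.2, one_mul]

theorem HasCubicApprox.prodExp {Z : Type*} [Fintype Z] {M : ℝ} {φ : ℝ → ℝ}
    (hφ : HasCubicApprox M φ) {n : ℕ} {q : Fin n → Z → ℝ} (hq : ∀ j, IsProbMass (q j))
    (s : Fin n → Z → ℝ) : HasCubicApprox M (prodExp q s φ) := by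
  induction n with
  | zero => simpa only [funext (prodExp_zero q s φ)] using hφ
  | succ n ih =>
    rw [funext (prodExp_succ q s φ)]
    exact HasCubicApprox.average (fun _ => ih (fun j => hq j.succ) _) (hq 0) _

/-- Lindeberg replacement of one family of independent variables by another. -/
theorem abs_prodExp_sub_le {Z : Type*} [Fintype Z] {M : ℝ} {n : ℕ} {p q : Fin n → Z → ℝ}
    (hp : ∀ j, IsProbMass (p j)) (hq : ∀ j, IsProbMass (q j)) (s : Fin n → Z → ℝ) (e : Fin n → ℝ)
    (he : ∀ j φ, HasCubicApprox M φ → ∀ c,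
      |∑ z, p j z * φ (c + s j z) - ∑ z, q j z * φ (c + s j z)| ≤ e j)
    {φ : ℝ → ℝ} (hφ : HasCubicApprox M φ) (c : ℝ) :
    |prodExp p s φ c - prodExp q s φ c| ≤ ∑ j, e j := by
  induction n generalizing c with
  | zero => simp [prodExp_zero]
  | succ n ih =>
    rw [prodExp_succ, prodExp_succ, Fin.sum_univ_succ]
    set P := DictTest.prodExp (fun j => p j.succ) (fun j => s j.succ) φ
    set Q := DictTest.prodExp (fun j => q j.succ) (fun j => s j.succ) φ
    have h1 : |∑ z, p 0 z * P (c + s 0 z) - ∑ z, p 0 z * Q (c + s 0 z)| ≤ ∑ j : Fin n, e j.succ := by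
      rw [← Finset.sum_sub_distrib]
      calc _ ≤ ∑ z, |p 0 z * P (c + s 0 z) - p 0 z * Q (c + s 0 z)| :=
            Finset.abs_sum_le_sum_abs _ _
        _ ≤ ∑ z, p 0 z * ∑ j : Fin n, e j.succ := by
            refine Finset.sum_le_sum fun z _ => ?_
            rw [← mul_sub, abs_mul, abs_of_nonneg ((hp 0).1 z)]
            exact mul_le_mul_of_nonneg_left (ih (fun j => hp j.succ) (fun j => hq j.succ) _ _
              (fun j => he j.succ) _) ((hp 0).1 z)
        _ = _ := by rw [← Finset.sum_mul, (hp 0).2, one_mul]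
    have h2 := he 0 Q (hφ.prodExp (fun j => hq j.succ) _) c
    have h3 := abs_sub_le (∑ z, p 0 z * P (c + s 0 z)) (∑ z, p 0 z * Q (c + s 0 z))
      (∑ z, q 0 z * Q (c + s 0 z))
    linarith

/-- The expectation of a character of a sum of independent variables is a product. -/
theorem sum_prod_mul_cexp {Z : Type*} [Fintype Z] {n : ℕ} (q s : Fin n → Z → ℝ) (u : ℝ) :
    ∑ y : Fin n → Z, ((∏ j, q j (y j) : ℝ) : ℂ) * Complex.exp ((u * ∑ j, s j (y j) : ℝ) * Complex.I)
      = ∏ j, ∑ z, (q j z : ℂ) * Complex.exp ((u * s j z : ℝ) * Complex.I) := by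
  rw [Finset.prod_univ_sum]
  simp only [Fintype.piFinset_univ]
  refine Finset.sum_congr rfl fun y _ => ?_
  rw [Finset.prod_mul_distrib, ← Complex.exp_sum]
  push_cast
  rw [Finset.mul_sum, Finset.sum_mul]

/-- If the points of `A` are determined by their bits outside `E`, then `A` has mass at
most `ρ ^ #E` under a product mass whose factors are bounded by `ρ`. -/
theorem sum_prod_le_pow_card {ι : Type*} [Fintype ι] [DecidableEq ι] {n : ι → Bool → ℝ}
    (hn : ∀ e, IsProbMass (n e)) {ρ : ℝ} (hρ : ∀ e b, n e b ≤ ρ) (E : Finset ι)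
    (A : Finset (ι → Bool))
    (hA : ∀ y ∈ A, ∀ y' ∈ A, (∀ e ∉ E, y e = y' e) → y = y') :
    ∑ y ∈ A, ∏ e, n e (y e) ≤ ρ ^ E.card := by
  have hρ0 : 0 ≤ ρ ∨ IsEmpty ι := by
    rcases isEmpty_or_nonempty ι with h | ⟨⟨e⟩⟩
    · exact Or.inr h
    · exact Or.inl (((hn e).1 true).trans (hρ e true))
  have hpow : 0 ≤ ρ ^ E.card := by
    rcases hρ0 with h | h
    · positivity
    · simp [Finset.eq_empty_of_isEmpty E]
  calc ∑ y ∈ A, ∏ e, n e (y e)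
      ≤ ∑ y ∈ A, ρ ^ E.card * ∏ e : {e // e ∉ E}, n e (y e) := by
        refine Finset.sum_le_sum fun y _ => ?_
        rw [← Fintype.prod_subtype_mul_prod_subtype (fun e => e ∈ E)]
        refine mul_le_mul_of_nonneg_right ?_ (Finset.prod_nonneg fun e _ => (hn e).1 _)
        refine (Finset.prod_le_prod (fun e _ => (hn _).1 _) (fun e _ => hρ _ _)).trans ?_
        simp
    _ = ρ ^ E.card * ∑ y ∈ A, ∏ e : {e // e ∉ E}, n e (y e) := by rw [Finset.mul_sum]
    _ ≤ ρ ^ E.card * ∑ v : {e // e ∉ E} → Bool, ∏ e : {e // e ∉ E}, n e (v e) := by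
        refine mul_le_mul_of_nonneg_left ?_ hpow
        have hinj : Set.InjOn (fun (y : ι → Bool) (e : {e // e ∉ E}) => y e) A :=
          fun y hy y' hy' h => hA y hy y' hy' fun e he => congrFun h ⟨e, he⟩
        rw [← Finset.sum_image (f := fun v : {e // e ∉ E} → Bool => ∏ e : {e // e ∉ E}, n e (v e)) hinj]
        exact Finset.sum_le_sum_of_subset_of_nonneg (Finset.subset_univ _)
          fun v _ _ => Finset.prod_nonneg fun e _ => (hn e).1 _
    _ = ρ ^ E.card := by
        rw [← Fintype.prod_sum (fun (e : {e // e ∉ E}) (b : Bool) => n e b)]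
        have h2 : ∀ e, ∑ b, n e b = 1 := fun e => (hn e).2
        simp only [h2, Finset.prod_const_one, mul_one]

/-- Signed sums of a sequence decreasing by a factor `3` are bounded below. -/
theorem abs_sum_ge_of_chain {s : ℕ} {a d : ℕ → ℝ} (ha : ∀ l, l + 1 < s → 3 * |a (l + 1)| ≤ |a l|)
    (hd : ∀ l, d l = -1 ∨ d l = 0 ∨ d l = 1) (hne : ∃ l < s, d l ≠ 0) :
    |a (s - 1)| / 2 ≤ |∑ l ∈ Finset.range s, a l * d l| := by
  induction s with
  | zero => simp at hne
  | succ s ih =>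
    rw [Finset.sum_range_succ, Nat.add_sub_cancel]
    have hd1 : |d s| ≤ 1 := by rcases hd s with h | h | h <;> simp [h]
    by_cases h : ∃ l < s, d l ≠ 0
    · have h1 := ih (fun l hl => ha l (by omega)) h
      obtain ⟨l, hl, -⟩ := h
      have h2 := ha (s - 1) (by omega)
      rw [Nat.sub_add_cancel (by omega)] at h2
      have h3 : |a s * d s| ≤ |a s| := by
        rw [abs_mul]; exact mul_le_of_le_one_right (abs_nonneg _) hd1
      have h4 := abs_sub_abs_le_abs_add (∑ l ∈ Finset.range s, a l * d l) (a s * d s)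
      linarith
    · push Not at h
      rw [Finset.sum_eq_zero fun l hl => by rw [h l (Finset.mem_range.1 hl), mul_zero], zero_add]
      obtain ⟨l, hl, hl0⟩ := hne
      have : l = s := by
        by_contra hls
        exact hl0 (h l (by omega))
      subst this
      have : |d l| = 1 := by rcases hd l with h | h | h <;> simp_all
      rw [abs_mul, this, mul_one]
      linarith [abs_nonneg (a l)]

/-! ### Columns of the test distribution -/

/-- Mass of a noisy column drawn from `𝒟_b`. -/
def colMass (k : ℕ) (b : Bool) (z : Fin k → Bool) : ℝ :=
  ∑ x, D k b x * ∏ i, noiseMass k (x i) (z i)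

theorem D_isProbMass {k : ℕ} (hk : 12 ^ 6 ≤ k) (b : Bool) : IsProbMass (D k b) := by
  cases b
  · simpa [D] using D0_isProbMass hk
  · simpa [D] using D1_isProbMass hk

theorem noiseRate_le_one {k : ℕ} (hk : 12 ^ 6 ≤ k) : 1 / (k : ℝ) ^ 2 ≤ 1 := by
  have hk1 : (1 : ℝ) ≤ k := by exact_mod_cast le_trans (by norm_num) hk
  rw [div_le_one (by positivity)]
  exact one_le_pow₀ hk1

theorem noiseMass_isProbMass {k : ℕ} (hk : 12 ^ 6 ≤ k) (x : Bool) :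
    IsProbMass (noiseMass k x) := by
  have := noiseRate_le_one hk
  constructor
  · intro y
    refine add_nonneg (mul_nonneg (by linarith) (by split_ifs <;> norm_num)) (by positivity)
  · cases x <;> simp [noiseMass] <;> ring

theorem noiseMass_le {k : ℕ} (hk : 12 ^ 6 ≤ k) (x y : Bool) :
    noiseMass k x y ≤ 1 - 1 / (k : ℝ) ^ 2 / 2 := by
  have := noiseRate_le_one hk
  unfold noiseMass
  split_ifs <;> linarith

/-- Average over the noise of a product of functions of the bits. -/
theorem sum_noise_mul_prod {𝕜 : Type*} [CommSemiring 𝕜] {ι : Type*} [Fintype ι] [DecidableEq ι]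
    (n f : ι → Bool → 𝕜) :
    ∑ z : ι → Bool, (∏ i, n i (z i)) * ∏ i, f i (z i) = ∏ i, ∑ b, n i b * f i b := by
  rw [Finset.prod_univ_sum]
  simp only [Fintype.piFinset_univ, Finset.prod_mul_distrib]

theorem colMass_isProbMass {k : ℕ} (hk : 12 ^ 6 ≤ k) (b : Bool) : IsProbMass (colMass k b) := by
  constructor
  · intro z
    exact Finset.sum_nonneg fun x _ => mul_nonneg ((D_isProbMass hk b).1 x)
      (Finset.prod_nonneg fun i _ => (noiseMass_isProbMass hk _).1 _)
  · unfold colMass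
    rw [Finset.sum_comm]
    simp_rw [← Finset.mul_sum]
    have h : ∀ x : Fin k → Bool, ∑ z : Fin k → Bool, ∏ i, noiseMass k (x i) (z i) = 1 := by
      intro x
      rw [← Fintype.prod_sum (fun (i : Fin k) (c : Bool) => noiseMass k (x i) c)]
      exact Finset.prod_eq_one fun i _ => (noiseMass_isProbMass hk _).2
    simp [h, (D_isProbMass hk b).2]

theorem sum_iidMass_mul_prod (k : ℕ) (p : ℝ) (T : Finset (Fin k)) :
    ∑ x, iidMass k p x * ∏ i ∈ T, bit (x i) = p ^ T.card := by
  have h : ∀ x : Fin k → Bool, ∏ i ∈ T, bit (x i) = ∏ i, if i ∈ T then bit (x i) else 1 := by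
    intro x
    rw [Finset.prod_ite_mem, Finset.univ_inter]
  simp_rw [h, iidMass]
  rw [sum_noise_mul_prod (fun _ b => if b then p else 1 - p)
    (fun i b => if i ∈ T then bit b else 1)]
  have h2 : ∀ i, ∑ b : Bool, (if b then p else 1 - p) * (if i ∈ T then bit b else 1)
      = if i ∈ T then p else 1 := by
    intro i
    split_ifs <;> simp [bit]
  simp_rw [h2]
  rw [Finset.prod_ite_mem, Finset.univ_inter, Finset.prod_const]

theorem sum_zeroMass_mul (k : ℕ) (f : (Fin k → Bool) → ℝ) :
    ∑ x, zeroMass k x * f x = f (fun _ => false) := by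
  simp [zeroMass]

theorem sum_oneHotMass_mul (k : ℕ) (f : (Fin k → Bool) → ℝ) :
    ∑ x, oneHotMass k x * f x = 1 / (k : ℝ) * ∑ i, f (fun j => decide (j = i)) := by
  simp_rw [oneHotMass, mul_assoc, ← Finset.mul_sum, Finset.sum_mul]
  rw [Finset.sum_comm]
  simp

/-- The moments of `𝒟₀` and `𝒟₁` of degree at most `4` coincide. -/
theorem sum_D_mul_prod {k : ℕ} (hk : 0 < k) {T : Finset (Fin k)} (hT : T.card ≤ 4) :
    ∑ x, D1 k x * ∏ i ∈ T, bit (x i) = ∑ x, D0 k x * ∏ i ∈ T, bit (x i) := by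
  have e1 : ∑ x, D1 k x * ∏ i ∈ T, bit (x i)
      = (1 - eps k) * (1 / (k : ℝ) * ∑ i, ∏ l ∈ T, bit (decide (l = i)))
        + ∑ a, eps k / 4 * bias k a ^ T.card := by
    simp_rw [← sum_iidMass_mul_prod, ← sum_oneHotMass_mul k fun x => ∏ i ∈ T, bit (x i),
      D1, add_mul, Finset.sum_add_distrib, Finset.sum_mul, Finset.mul_sum, mul_assoc]
    rw [add_right_inj]
    exact Finset.sum_comm
  have e0 : ∑ x, D0 k x * ∏ i ∈ T, bit (x i)
      = (1 - ∑ a, weight k a) * (∏ l ∈ T, bit false)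
        + ∑ a, weight k a * bias k a ^ T.card := by
    simp_rw [← sum_iidMass_mul_prod, ← sum_zeroMass_mul k fun x => ∏ i ∈ T, bit (x i),
      D0, add_mul, Finset.sum_add_distrib, Finset.sum_mul, Finset.mul_sum, mul_assoc]
    rw [add_right_inj]
    exact Finset.sum_comm
  rw [e1, e0]
  have hk' : (k : ℝ) ≠ 0 := by exact_mod_cast hk.ne'
  rcases Nat.lt_or_ge T.card 2 with h2 | h2
  · rcases Nat.lt_or_ge T.card 1 with h1 | h1
    · obtain rfl : T = ∅ := Finset.card_eq_zero.1 (by omega)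
      simp [hk']
      ring
    · obtain ⟨i, rfl⟩ := Finset.card_eq_one.1 (by omega : T.card = 1)
      have := weights_first_moment hk
      simp only [Finset.prod_singleton, Finset.card_singleton, pow_one, this]
      simp [bit]
      ring
  · have h3 := weights_higher_moments (k := k) (d := T.card) (by
      simp only [Finset.mem_insert, Finset.mem_singleton]; omega)
    rw [h3]
    have h4 : ∀ i, ∏ l ∈ T, bit (decide (l = i)) = 0 := by
      intro i
      obtain ⟨l, hl, hli⟩ := Finset.exists_mem_ne (by omega : 1 < T.card) i
      exact Finset.prod_eq_zero hl (by simp [bit, hli])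
    have h5 : ∏ l ∈ T, bit false = 0 := by
      obtain ⟨l, hl⟩ := Finset.card_pos.1 (by omega : 0 < T.card)
      exact Finset.prod_eq_zero hl (by simp [bit])
    simp [h4, h5]

theorem sum_colMass_mul_prod_eq {k : ℕ} (hk : 12 ^ 6 ≤ k) (b : Bool) (T : Finset (Fin k)) :
    ∑ z, colMass k b z * ∏ i ∈ T, bit (z i) = ∑ U ∈ T.powerset, (1 - 1 / (k : ℝ) ^ 2) ^ U.card
      * (1 / (k : ℝ) ^ 2 / 2) ^ (T \ U).card * ∑ x, D k b x * ∏ i ∈ U, bit (x i) := by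
  have h : ∀ x : Fin k → Bool, ∑ z : Fin k → Bool,
      (∏ i, noiseMass k (x i) (z i)) * ∏ i ∈ T, bit (z i)
      = ∏ i ∈ T, ((1 - 1 / (k : ℝ) ^ 2) * bit (x i) + 1 / (k : ℝ) ^ 2 / 2) := by
    intro x
    have h : ∀ z : Fin k → Bool, ∏ i ∈ T, bit (z i) = ∏ i, if i ∈ T then bit (z i) else 1 := by
      intro z
      rw [Finset.prod_ite_mem, Finset.univ_inter]
    simp_rw [h]
    rw [sum_noise_mul_prod (fun i b => noiseMass k (x i) b)
      (fun i b => if i ∈ T then bit b else 1)]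
    have h2 : ∀ i, ∑ b : Bool, noiseMass k (x i) b * (if i ∈ T then bit b else 1)
        = if i ∈ T then ((1 - 1 / (k : ℝ) ^ 2) * bit (x i) + 1 / (k : ℝ) ^ 2 / 2) else 1 := by
      intro i
      split_ifs
      · cases x i <;> simp [bit, noiseMass] <;> ring
      · simpa using (noiseMass_isProbMass hk (x i)).2
    simp_rw [h2]
    rw [Finset.prod_ite_mem, Finset.univ_inter]
  simp_rw [colMass, Finset.sum_mul]
  rw [Finset.sum_comm]
  simp_rw [mul_assoc, ← Finset.mul_sum, h, Finset.prod_add, Finset.prod_mul_distrib,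
    Finset.prod_const, Finset.mul_sum]
  rw [Finset.sum_comm]
  refine Finset.sum_congr rfl fun U _ => Finset.sum_congr rfl fun x _ => by ring

theorem sum_colMass_mul_prod {k : ℕ} (hk : 12 ^ 6 ≤ k) {T : Finset (Fin k)} (hT : T.card ≤ 4) :
    ∑ z, colMass k true z * ∏ i ∈ T, bit (z i) = ∑ z, colMass k false z * ∏ i ∈ T, bit (z i) := by
  rw [sum_colMass_mul_prod_eq hk, sum_colMass_mul_prod_eq hk]
  refine Finset.sum_congr rfl fun U hU => ?_
  have := sum_D_mul_prod (lt_of_lt_of_le (by norm_num) hk)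
    ((Finset.card_le_card (Finset.mem_powerset.1 hU)).trans hT)
  simp only [D, if_true, Bool.false_eq_true, if_false, this]

/-- Products of at most four bits, with repetitions, have equal expectations. -/
theorem sum_colMass_mul_list_prod {k : ℕ} (hk : 12 ^ 6 ≤ k) {d : ℕ} (hd : d ≤ 4)
    (p : Fin d → Fin k) :
    ∑ z, colMass k true z * ∏ m, bit (z (p m)) = ∑ z, colMass k false z * ∏ m, bit (z (p m)) := by
  have h : ∀ z : Fin k → Bool, ∏ m, bit (z (p m)) = ∏ i ∈ Finset.univ.image p, bit (z i) := by
    intro z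
    by_cases hz : ∀ m, z (p m) = true
    · rw [Finset.prod_eq_one fun m _ => by simp [bit, hz m], Finset.prod_eq_one]
      intro i hi
      obtain ⟨m, -, rfl⟩ := Finset.mem_image.1 hi
      simp [bit, hz m]
    · push Not at hz
      obtain ⟨m, hm⟩ := hz
      rw [Finset.prod_eq_zero (Finset.mem_univ m) (by simp [bit, hm]),
        Finset.prod_eq_zero (Finset.mem_image_of_mem p (Finset.mem_univ m)) (by simp [bit, hm])]
  simp_rw [h]
  refine sum_colMass_mul_prod hk (Finset.card_image_le.trans ?_)
  simpa using hd

theorem sum_colMass_mul_pow {k : ℕ} (hk : 12 ^ 6 ≤ k) (v : Fin k → ℝ) {d : ℕ} (hd : d ≤ 3)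
    (i₀ : Fin k) :
    (∑ z, colMass k true z * (∑ i, v i * bit (z i)) ^ d
      = ∑ z, colMass k false z * (∑ i, v i * bit (z i)) ^ d) ∧
    ∑ z, colMass k true z * (bit (z i₀) * (∑ i, v i * bit (z i)) ^ d)
      = ∑ z, colMass k false z * (bit (z i₀) * (∑ i, v i * bit (z i)) ^ d) := by
  have h : ∀ z : Fin k → Bool, (∑ i, v i * bit (z i)) ^ d
      = ∑ p : Fin d → Fin k, (∏ m, v (p m)) * ∏ m, bit (z (p m)) := by
    intro z
    have := Finset.prod_univ_sum (fun _ : Fin d => (Finset.univ : Finset (Fin k)))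
      (fun _ i => v i * bit (z i))
    simp only [Finset.prod_const, Finset.card_univ, Fintype.card_fin, Fintype.piFinset_univ,
      Finset.prod_mul_distrib] at this
    exact this
  constructor
  · simp_rw [h, Finset.mul_sum]
    rw [Finset.sum_comm, Finset.sum_comm (s := Finset.univ (α := Fin k → Bool))]
    refine Finset.sum_congr rfl fun p _ => ?_
    simp_rw [mul_left_comm _ (∏ m, v (p m)), ← Finset.mul_sum]
    rw [sum_colMass_mul_list_prod hk (by omega)]
  · simp_rw [h, Finset.mul_sum]
    rw [Finset.sum_comm, Finset.sum_comm (s := Finset.univ (α := Fin k → Bool))]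
    refine Finset.sum_congr rfl fun p _ => ?_
    have := sum_colMass_mul_list_prod hk (d := d + 1) (by omega) (Fin.cons i₀ p)
    simp only [Fin.prod_univ_succ, Fin.cons_zero, Fin.cons_succ] at this
    simp_rw [mul_left_comm _ (∏ m, v (p m)), ← Finset.mul_sum]
    rw [this]

/-- Replacing a column of `𝒟₁` by a column of `𝒟₀` in a smooth function of a linear form, one
coefficient of which is arbitrary. -/
theorem abs_colMass_sub_le {k : ℕ} (hk : 12 ^ 6 ≤ k) {M : ℝ} {φ : ℝ → ℝ}
    (hφ : HasCubicApprox M φ) (hM : 0 ≤ M) (c a : ℝ) (v : Fin k → ℝ) (i₀ : Fin k) :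
    |∑ z, colMass k true z * φ (c + (a * bit (z i₀) + ∑ i, v i * bit (z i)))
      - ∑ z, colMass k false z * φ (c + (a * bit (z i₀) + ∑ i, v i * bit (z i)))|
      ≤ 2 * (M * (∑ i, |v i|) ^ 4) := by
  obtain ⟨f, hf⟩ := hφ
  set g : (Fin k → Bool) → ℝ := fun z => ∑ d ∈ Finset.range 4,
    (f d c + bit (z i₀) * (f d (c + a) - f d c)) * (∑ i, v i * bit (z i)) ^ d with hg
  have hgeq : ∑ z, colMass k true z * g z = ∑ z, colMass k false z * g z := by
    have : ∀ b, ∑ z, colMass k b z * g z = ∑ d ∈ Finset.range 4,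
        (f d c * ∑ z, colMass k b z * (∑ i, v i * bit (z i)) ^ d + (f d (c + a) - f d c) *
          ∑ z, colMass k b z * (bit (z i₀) * (∑ i, v i * bit (z i)) ^ d)) := by
      intro b
      simp_rw [hg, Finset.mul_sum]
      rw [Finset.sum_comm]
      refine Finset.sum_congr rfl fun d _ => ?_
      rw [← Finset.sum_add_distrib]
      exact Finset.sum_congr rfl fun z _ => by ring
    rw [this, this]
    refine Finset.sum_congr rfl fun d hd => ?_
    have hd' := Finset.mem_range.1 hd
    obtain ⟨h1, h2⟩ := sum_colMass_mul_pow hk v (d := d) (by omega) i₀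
    rw [h1, h2]
  have happ : ∀ z, |φ (c + (a * bit (z i₀) + ∑ i, v i * bit (z i))) - g z|
      ≤ M * (∑ i, |v i|) ^ 4 := by
    intro z
    have hU : M * (∑ i, v i * bit (z i)) ^ 4 ≤ M * (∑ i, |v i|) ^ 4 := by
      refine mul_le_mul_of_nonneg_left ?_ hM
      rw [← Even.pow_abs (by decide : Even 4)]
      refine pow_le_pow_left₀ (abs_nonneg _) ((Finset.abs_sum_le_sum_abs _ _).trans ?_) 4
      refine Finset.sum_le_sum fun i _ => ?_
      cases z i <;> simp [bit]
    refine le_trans ?_ hU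
    rw [← add_assoc, hg]
    have hb : bit (z i₀) = 0 ∨ bit (z i₀) = 1 := by cases z i₀ <;> simp [bit]
    rcases hb with hb | hb
    · simpa [hb] using hf c (∑ i, v i * bit (z i))
    · simpa [hb] using hf (c + a) (∑ i, v i * bit (z i))
  have hdiff : ∀ b, |∑ z, colMass k b z * φ (c + (a * bit (z i₀) + ∑ i, v i * bit (z i)))
      - ∑ z, colMass k b z * g z| ≤ M * (∑ i, |v i|) ^ 4 := by
    intro b
    have hb := colMass_isProbMass hk b
    rw [← Finset.sum_sub_distrib]
    refine (Finset.abs_sum_le_sum_abs _ _).trans ?_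
    calc _ ≤ ∑ z, colMass k b z * (M * (∑ i, |v i|) ^ 4) := by
          refine Finset.sum_le_sum fun z _ => ?_
          rw [← mul_sub, abs_mul, abs_of_nonneg (hb.1 z)]
          exact mul_le_mul_of_nonneg_left (happ z) (hb.1 z)
      _ = _ := by rw [← Finset.sum_mul, hb.2, one_mul]
  have h1 := abs_le.1 (hdiff true)
  have h2 := abs_le.1 (hdiff false)
  rw [abs_le]
  constructor <;> linarith [h1.1, h1.2, h2.1, h2.2]

/-! ### Smooth steps -/

theorem bddAbove_iteratedDeriv_smoothTransition :
    ∃ K : ℝ, 0 ≤ K ∧ ∀ x, |iteratedDeriv 4 Real.smoothTransition x| ≤ K := by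
  have hc : Continuous (iteratedDeriv 4 Real.smoothTransition) :=
    Real.smoothTransition.contDiff.continuous_iteratedDeriv 4 le_rfl
  obtain ⟨K, hK⟩ := (isCompact_Icc (a := (0 : ℝ)) (b := 1)).exists_bound_of_continuousOn
    hc.continuousOn
  have hK0 : 0 ≤ K := (norm_nonneg _).trans (hK 0 (by simp))
  refine ⟨K, hK0, fun x => ?_⟩
  by_cases hx : x ∈ Set.Icc (0 : ℝ) 1
  · exact hK x hx
  · have h : ∃ v : ℝ, Real.smoothTransition =ᶠ[nhds x] fun _ => v := by
      rcases lt_or_ge x 0 with h0 | h0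
      · refine ⟨0, ?_⟩
        filter_upwards [Iio_mem_nhds h0] with y hy
        exact Real.smoothTransition.zero_of_nonpos (le_of_lt hy)
      · have h1 : 1 < x := by
          by_contra h1
          exact hx ⟨h0, not_lt.1 h1⟩
        refine ⟨1, ?_⟩
        filter_upwards [Ioi_mem_nhds h1] with y hy
        exact Real.smoothTransition.one_of_one_le (le_of_lt hy)
    obtain ⟨v, hv⟩ := h
    rw [hv.iteratedDeriv_eq, iteratedDeriv_const]
    simpa using hK0

theorem hasCubicApprox_of_iteratedDeriv {f : ℝ → ℝ} (hf : ContDiff ℝ 4 f) {K : ℝ}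
    (hK : ∀ x, |iteratedDeriv 4 f x| ≤ K) : HasCubicApprox K f := by
  have hK0 : 0 ≤ K := (abs_nonneg _).trans (hK 0)
  refine ⟨fun d x => iteratedDeriv d f x / d.factorial, fun x u => ?_⟩
  rcases eq_or_ne u 0 with rfl | hu
  · simp [Finset.sum_range_succ, iteratedDeriv_zero]
  have hne : x ≠ x + u := fun h => hu (by linarith)
  obtain ⟨y, -, hy⟩ := taylor_mean_remainder_lagrange_iteratedDeriv (n := 3) hne
    (f := f) (by exact_mod_cast hf.contDiffOn)
  have ht : taylorWithinEval f 3 (Set.uIcc x (x + u)) x (x + u)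
      = ∑ d ∈ Finset.range 4, iteratedDeriv d f x / d.factorial * u ^ d := by
    rw [taylor_within_apply]
    refine Finset.sum_congr rfl fun d hd => ?_
    have hd' : d < 4 := Finset.mem_range.1 hd
    rw [iteratedDerivWithin_eq_iteratedDeriv (uniqueDiffOn_uIcc hne)
      ((hf.of_le (by exact_mod_cast hd'.le)).contDiffAt) Set.left_mem_uIcc]
    simp [div_eq_mul_inv]
    ring
  rw [← ht, hy]
  have h4 : (0 : ℝ) ≤ u ^ 4 := by positivity
  rw [add_sub_cancel_left, abs_div, abs_mul, abs_of_nonneg (show (0 : ℝ) ≤ u ^ (3 + 1) from h4)]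
  have h24 : |((3 + 1).factorial : ℝ)| = 24 := by norm_num [Nat.factorial]
  rw [h24, div_le_iff₀ (by norm_num)]
  have := mul_le_mul_of_nonneg_right (hK y) h4
  have h5 : 0 ≤ K * u ^ 4 := by positivity
  norm_num at this ⊢
  linarith

theorem HasCubicApprox.comp_affine {M : ℝ} {φ : ℝ → ℝ} (hφ : HasCubicApprox M φ) (r c : ℝ) :
    HasCubicApprox (M * r ^ 4) (fun x => φ (c + r * x)) := by
  obtain ⟨a, ha⟩ := hφ
  refine ⟨fun d x => a d (c + r * x) * r ^ d, fun x u => ?_⟩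
  have := ha (c + r * x) (r * u)
  simp only [mul_pow] at this
  simp_rw [mul_add, ← add_assoc, mul_assoc] at this ⊢
  exact this

/-- Smooth upper approximations of the indicator of `[0, ∞)`, at every scale. -/
theorem exists_smooth_step : ∃ K : ℝ, 0 ≤ K ∧ ∀ l : ℝ, 0 < l → ∃ Ψ : ℝ → ℝ,
    HasCubicApprox (K / l ^ 4) Ψ ∧ (∀ x, 0 ≤ Ψ x) ∧ (∀ x, Ψ x ≤ 1) ∧ (∀ x, 0 ≤ x → Ψ x = 1) ∧
      ∀ x, x ≤ -l → Ψ x = 0 := by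
  obtain ⟨K, hK0, hK⟩ := bddAbove_iteratedDeriv_smoothTransition
  refine ⟨K, hK0, fun l hl => ⟨fun x => Real.smoothTransition (1 + l⁻¹ * x), ?_,
    fun x => Real.smoothTransition.nonneg _, fun x => Real.smoothTransition.le_one _,
    fun x hx => Real.smoothTransition.one_of_one_le ?_,
    fun x hx => Real.smoothTransition.zero_of_nonpos ?_⟩⟩
  · have := (hasCubicApprox_of_iteratedDeriv Real.smoothTransition.contDiff hK).comp_affine l⁻¹ 1
    rwa [inv_pow, ← div_eq_mul_inv] at this
  · have : 0 ≤ l⁻¹ * x := by positivity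
    linarith
  · have : l⁻¹ * x ≤ l⁻¹ * -l := by gcongr
    rw [mul_neg, inv_mul_cancel₀ hl.ne'] at this
    linarith

/-! ### Small ball probabilities -/

theorem integral_exp_neg_mul_sq_gaussianReal {a : ℝ} (ha : 0 ≤ a) :
    ∫ g, Real.exp (-(a * g ^ 2)) ∂(ProbabilityTheory.gaussianReal 0 1) = 1 / √(1 + 2 * a) := by
  rw [ProbabilityTheory.integral_gaussianReal_eq_integral_smul one_ne_zero]
  have h : ∀ g : ℝ, ProbabilityTheory.gaussianPDFReal 0 1 g • Real.exp (-(a * g ^ 2))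
      = (√(2 * Real.pi))⁻¹ * Real.exp (-(1 / 2 + a) * g ^ 2) := by
    intro g
    rw [ProbabilityTheory.gaussianPDFReal, smul_eq_mul, mul_assoc, ← Real.exp_add]
    simp only [NNReal.coe_one, mul_one, sub_zero]
    congr 2
    ring
  simp_rw [h]
  rw [MeasureTheory.integral_const_mul, integral_gaussian, ← Real.sqrt_inv,
    ← Real.sqrt_mul (by positivity), ← Real.sqrt_one, ← Real.sqrt_div (by norm_num), Real.sqrt_one]
  congr 1
  have := Real.pi_pos
  field_simp

theorem integral_sq_gaussianReal :
    ∫ g, g ^ 2 ∂(ProbabilityTheory.gaussianReal 0 1) = 1 := by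
  have h := ProbabilityTheory.variance_fun_id_gaussianReal (μ := 0) (v := 1)
  rw [ProbabilityTheory.variance_eq_integral (by fun_prop)] at h
  simpa using h

/-- A bound on the characteristic function yields a bound on small ball probabilities. -/
theorem sum_abs_sub_le_of_charFun {Y : Type*} [Fintype Y] {q : Y → ℝ} (hq : ∀ y, 0 ≤ q y)
    (X : Y → ℝ) {a b : ℝ} (ha : 0 ≤ a)
    (h : ∀ u : ℝ, ‖∑ y, (q y : ℂ) * Complex.exp ((u * X y : ℝ) * Complex.I)‖
      ≤ Real.exp (-(a * u ^ 2)) + b * u ^ 2) (c : ℝ) :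
    ∑ y with |X y - c| ≤ 1, q y ≤ 2 * (1 / √(1 + 2 * a) + b) := by
  set N := ProbabilityTheory.gaussianReal 0 1
  have hint : ∀ t : ℝ, MeasureTheory.Integrable
      (fun g : ℝ => Complex.exp (t * g * Complex.I)) N := by
    intro t
    refine MeasureTheory.Integrable.of_bound (by fun_prop) 1 (Filter.Eventually.of_forall fun g => ?_)
    rw [← Complex.ofReal_mul, Complex.norm_exp_ofReal_mul_I]
  have hchar : ∀ t : ℝ, ∫ g, Complex.exp (t * g * Complex.I) ∂N
      = (Real.exp (-(t ^ 2 / 2)) : ℝ) := by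
    intro t
    rw [← MeasureTheory.charFun_apply_real, ProbabilityTheory.charFun_gaussianReal]
    push_cast
    congr 1
    simp
  have h1 : ∑ y with |X y - c| ≤ 1, q y ≤ 2 * ∑ y, q y * Real.exp (-((X y - c) ^ 2 / 2)) := by
    rw [Finset.mul_sum, Finset.sum_filter]
    refine Finset.sum_le_sum fun y _ => ?_
    split_ifs with hy
    · have h2 : (X y - c) ^ 2 ≤ 1 := by
        rw [← sq_abs]
        exact pow_le_one₀ (abs_nonneg _) hy
      have h3 : 1 ≤ 2 * Real.exp (-((X y - c) ^ 2 / 2)) := by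
        have := Real.add_one_le_exp (-((X y - c) ^ 2 / 2))
        linarith
      nlinarith [mul_le_mul_of_nonneg_left h3 (hq y)]
    · have := hq y
      positivity
  have h2 : ((∑ y, q y * Real.exp (-((X y - c) ^ 2 / 2)) : ℝ) : ℂ)
      = ∫ g, ∑ y, (q y : ℂ) * Complex.exp ((X y - c : ℝ) * g * Complex.I) ∂N := by
    rw [MeasureTheory.integral_finsetSum _ fun y _ => (hint _).const_mul _]
    push_cast
    refine Finset.sum_congr rfl fun y _ => ?_
    rw [MeasureTheory.integral_const_mul]
    have := hchar (X y - c)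
    push_cast at this
    rw [this]
  have hi1 : MeasureTheory.Integrable (fun g : ℝ => Real.exp (-(a * g ^ 2))) N := by
    refine MeasureTheory.Integrable.of_bound (by fun_prop) 1 (Filter.Eventually.of_forall fun g => ?_)
    rw [Real.norm_eq_abs, abs_of_pos (Real.exp_pos _)]
    exact Real.exp_le_one_iff.2 (by have : 0 ≤ a * g ^ 2 := by positivity
                                    linarith)
  have hi2 : MeasureTheory.Integrable (fun g : ℝ => b * g ^ 2) N :=
    ((ProbabilityTheory.memLp_id_gaussianReal 2).integrable_sq).const_mul b
  have h3 : ∑ y, q y * Real.exp (-((X y - c) ^ 2 / 2)) ≤ 1 / √(1 + 2 * a) + b := by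
    calc ∑ y, q y * Real.exp (-((X y - c) ^ 2 / 2))
        ≤ ‖((∑ y, q y * Real.exp (-((X y - c) ^ 2 / 2)) : ℝ) : ℂ)‖ := by
          rw [Complex.norm_real]
          exact le_abs_self _
      _ ≤ ∫ g, (Real.exp (-(a * g ^ 2)) + b * g ^ 2) ∂N := by
          rw [h2]
          refine MeasureTheory.norm_integral_le_of_norm_le (hi1.add hi2)
            (Filter.Eventually.of_forall fun g => ?_)
          refine le_trans (le_of_eq ?_) (h g)
          have : ∑ y, (q y : ℂ) * Complex.exp ((X y - c : ℝ) * g * Complex.I)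
              = Complex.exp ((-(c * g) : ℝ) * Complex.I) *
                ∑ y, (q y : ℂ) * Complex.exp ((g * X y : ℝ) * Complex.I) := by
            rw [Finset.mul_sum]
            refine Finset.sum_congr rfl fun y _ => ?_
            rw [mul_left_comm, ← Complex.exp_add]
            congr 2
            push_cast
            ring
          rw [this, norm_mul, Complex.norm_exp_ofReal_mul_I, one_mul]
      _ = 1 / √(1 + 2 * a) + b := by
          rw [MeasureTheory.integral_add hi1 hi2, MeasureTheory.integral_const_mul,
            integral_exp_neg_mul_sq_gaussianReal ha, integral_sq_gaussianReal, mul_one]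
  linarith

theorem norm_sum_bool_cexp_le {n : Bool → ℝ} (hn : IsProbMass n) (a : ℝ) :
    ‖∑ b, (n b : ℂ) * Complex.exp ((a * bit b : ℝ) * Complex.I)‖ ≤ 1 := by
  refine (norm_sum_le _ _).trans (le_of_eq ?_)
  rw [← hn.2]
  refine Finset.sum_congr rfl fun b _ => ?_
  rw [norm_mul, Complex.norm_exp_ofReal_mul_I, Complex.norm_real, Real.norm_of_nonneg (hn.1 b),
    mul_one]

theorem norm_sum_bool_cexp_le_exp {n : Bool → ℝ} (hn : IsProbMass n) {γ : ℝ} (hγ0 : 0 ≤ γ)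
    (hγ : γ ≤ 1) (hle : ∀ b, n b ≤ 1 - γ / 2) {a : ℝ} (ha : |a| ≤ 1) :
    ‖∑ b, (n b : ℂ) * Complex.exp ((a * bit b : ℝ) * Complex.I)‖ ≤ Real.exp (-(γ * a ^ 2 / 20)) := by
  have hsum : n true + n false = 1 := by simpa using hn.2
  have h1 := hle true
  have h2 := hle false
  set p := n true with hp
  have hf : n false = 1 - p := by linarith
  have hsq : ‖∑ b, (n b : ℂ) * Complex.exp ((a * bit b : ℝ) * Complex.I)‖ ^ 2
      = 1 - 2 * p * (1 - p) * (1 - Real.cos a) := by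
    have : ∑ b, (n b : ℂ) * Complex.exp ((a * bit b : ℝ) * Complex.I)
        = ((1 - p + p * Real.cos a : ℝ) : ℂ) + ((p * Real.sin a : ℝ) : ℂ) * Complex.I := by
      simp only [Fintype.sum_bool, bit, ← hp, hf]
      rw [if_pos trivial, if_neg (by simp), mul_one, mul_zero, Complex.exp_mul_I]
      push_cast
      simp
      ring
    rw [this, Complex.sq_norm, Complex.normSq_add_mul_I]
    have := Real.sin_sq_add_cos_sq a
    linear_combination p ^ 2 * this
  have hcos : Real.cos a ≤ 1 - a ^ 2 / 5 := by
    have h3 := Real.cos_le_one_sub_mul_cos_sq (x := a) (ha.trans (by linarith [Real.pi_gt_three]))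
    have h4 : (1 : ℝ) / 5 ≤ 2 / Real.pi ^ 2 := by
      rw [div_le_div_iff₀ (by norm_num) (by positivity)]
      nlinarith [Real.pi_lt_d2, Real.pi_pos]
    nlinarith [mul_le_mul_of_nonneg_right h4 (sq_nonneg a)]
  have hpp : γ / 4 ≤ p * (1 - p) := by
    nlinarith
  have hle : ‖∑ b, (n b : ℂ) * Complex.exp ((a * bit b : ℝ) * Complex.I)‖ ^ 2
      ≤ Real.exp (-(γ * a ^ 2 / 20)) ^ 2 := by
    rw [hsq, ← Real.exp_nat_mul]
    refine le_trans ?_ (Real.add_one_le_exp _)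
    have h5 : 0 ≤ a ^ 2 / 5 := by positivity
    have h6 : a ^ 2 / 5 ≤ 1 - Real.cos a := by linarith
    have h7 : γ / 4 * (a ^ 2 / 5) ≤ p * (1 - p) * (1 - Real.cos a) := by
      exact mul_le_mul hpp h6 h5 (le_trans (by positivity) hpp)
    push_cast
    linarith
  exact le_of_sq_le_sq hle (Real.exp_pos _).le

theorem norm_charFun_colMass_le {k : ℕ} (hk : 12 ^ 6 ≤ k) (b : Bool) (w : Fin k → ℝ) (u : ℝ)
    {r : ℝ} (hr : ∀ x : Fin k → Bool, ∏ i, ‖∑ c, (noiseMass k (x i) c : ℂ) *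
      Complex.exp ((u * w i * bit c : ℝ) * Complex.I)‖ ≤ r) :
    ‖∑ z, (colMass k b z : ℂ) * Complex.exp ((u * ∑ i, w i * bit (z i) : ℝ) * Complex.I)‖ ≤ r := by
  have h : ∑ z, (colMass k b z : ℂ) * Complex.exp ((u * ∑ i, w i * bit (z i) : ℝ) * Complex.I)
      = ∑ x, (D k b x : ℂ) * ∏ i, ∑ c, (noiseMass k (x i) c : ℂ) *
        Complex.exp ((u * w i * bit c : ℝ) * Complex.I) := by
    simp_rw [colMass, Complex.ofReal_sum, Finset.sum_mul]
    rw [Finset.sum_comm]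
    refine Finset.sum_congr rfl fun x _ => ?_
    rw [← sum_noise_mul_prod (fun i c => (noiseMass k (x i) c : ℂ))
      (fun i c => Complex.exp ((u * w i * bit c : ℝ) * Complex.I)), Finset.mul_sum]
    refine Finset.sum_congr rfl fun z _ => ?_
    rw [← Complex.exp_sum]
    push_cast
    rw [mul_assoc, Finset.mul_sum, Finset.sum_mul]
    simp_rw [mul_assoc]
  have hD := D_isProbMass hk b
  rw [h]
  refine (norm_sum_le _ _).trans ?_
  calc _ ≤ ∑ x, D k b x * r := by
        refine Finset.sum_le_sum fun x _ => ?_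
        rw [norm_mul, norm_prod, Complex.norm_real, Real.norm_of_nonneg (hD.1 x)]
        exact mul_le_mul_of_nonneg_left (hr x) (hD.1 x)
    _ = r := by rw [← Finset.sum_mul, hD.2, one_mul]

theorem norm_charFun_colMass_le_one {k : ℕ} (hk : 12 ^ 6 ≤ k) (b : Bool) (w : Fin k → ℝ) (u : ℝ) :
    ‖∑ z, (colMass k b z : ℂ) * Complex.exp ((u * ∑ i, w i * bit (z i) : ℝ) * Complex.I)‖ ≤ 1 :=
  norm_charFun_colMass_le hk b w u fun x => Finset.prod_le_one (fun _ _ => norm_nonneg _)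
    fun i _ => norm_sum_bool_cexp_le (noiseMass_isProbMass hk (x i)) _

theorem norm_charFun_colMass_le_exp {k : ℕ} (hk : 12 ^ 6 ≤ k) (b : Bool) (w : Fin k → ℝ) (u : ℝ)
    (i₀ : Fin k) (hu : |u * w i₀| ≤ 1) :
    ‖∑ z, (colMass k b z : ℂ) * Complex.exp ((u * ∑ i, w i * bit (z i) : ℝ) * Complex.I)‖
      ≤ Real.exp (-(1 / (k : ℝ) ^ 2 * (u * w i₀) ^ 2 / 20)) := by
  refine norm_charFun_colMass_le hk b w u fun x => ?_
  rw [← Finset.mul_prod_erase _ _ (Finset.mem_univ i₀)]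
  refine (mul_le_of_le_one_right (norm_nonneg _) (Finset.prod_le_one (fun _ _ => norm_nonneg _)
    fun i _ => norm_sum_bool_cexp_le (noiseMass_isProbMass hk (x i)) _)).trans ?_
  exact norm_sum_bool_cexp_le_exp (noiseMass_isProbMass hk _) (by positivity)
    (noiseRate_le_one hk) (noiseMass_le hk _) hu

/-- Small ball estimate for a linear form, one row of which is regular outside of a set `H`. -/
theorem small_ball_of_regular {k : ℕ} (hk : 12 ^ 6 ≤ k) {R : ℕ} (b : Bool)
    (w : Fin R → Fin k → ℝ) (i₀ : Fin k) (H : Finset (Fin R)) {W : ℝ} (hW : 0 < W)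
    (hsum : ∑ j ∈ Hᶜ, w j i₀ ^ 2 = W ^ 2) (hreg : ∀ j ∉ H, |w j i₀| ≤ tau k * W) (c : ℝ) :
    ∑ y : Fin R → Fin k → Bool with |(∑ j, ∑ i, w j i * bit (y j i)) - c| ≤ W / (k : ℝ) ^ 2,
      ∏ j, colMass k b (y j) ≤ 12 / k := by
  have hk0 : (0 : ℝ) < k := by exact_mod_cast lt_of_lt_of_le (by norm_num) hk
  have hk1 : (1 : ℝ) ≤ k := by exact_mod_cast le_trans (by norm_num) hk
  have ht : 0 < tau k := by unfold tau; positivity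
  have hl : 0 < W / (k : ℝ) ^ 2 := by positivity
  have hmass := colMass_isProbMass hk b
  have key : ∀ u : ℝ, ‖∑ y : Fin R → Fin k → Bool, ((∏ j, colMass k b (y j) : ℝ) : ℂ) *
      Complex.exp ((u * ((∑ j, ∑ i, w j i * bit (y j i)) / (W / (k : ℝ) ^ 2)) : ℝ) * Complex.I)‖
      ≤ Real.exp (-((k : ℝ) ^ 2 / 20 * u ^ 2)) + (tau k * (k : ℝ) ^ 2) ^ 2 * u ^ 2 := by
    intro u
    have hrew : ∀ y : Fin R → Fin k → Bool,
        u * ((∑ j, ∑ i, w j i * bit (y j i)) / (W / (k : ℝ) ^ 2))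
        = u / (W / (k : ℝ) ^ 2) * ∑ j, ∑ i, w j i * bit (y j i) := fun y => by ring
    simp_rw [hrew]
    rw [sum_prod_mul_cexp (fun _ => colMass k b) (fun j z => ∑ i, w j i * bit (z i)), norm_prod]
    set v := u / (W / (k : ℝ) ^ 2) with hv
    rcases le_or_gt (|v| * (tau k * W)) 1 with h1 | h1
    · refine le_add_of_le_of_nonneg ?_ (by positivity)
      calc _ ≤ ∏ j, (if j ∈ Hᶜ then Real.exp (-(1 / (k : ℝ) ^ 2 * (v * w j i₀) ^ 2 / 20)) else 1) := by
            refine Finset.prod_le_prod (fun _ _ => norm_nonneg _) fun j _ => ?_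
            split_ifs with hj
            · refine norm_charFun_colMass_le_exp hk b (w j) v i₀ ?_
              rw [abs_mul]
              refine le_trans ?_ h1
              exact mul_le_mul_of_nonneg_left (hreg j (Finset.mem_compl.1 hj)) (abs_nonneg _)
            · exact norm_charFun_colMass_le_one hk b (w j) v
        _ = Real.exp (-((k : ℝ) ^ 2 / 20 * u ^ 2)) := by
            rw [Finset.prod_ite_mem, Finset.univ_inter, ← Real.exp_sum]
            congr 1
            rw [Finset.sum_neg_distrib, neg_inj]
            have : ∀ j, 1 / (k : ℝ) ^ 2 * (v * w j i₀) ^ 2 / 20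
                = 1 / (k : ℝ) ^ 2 * v ^ 2 / 20 * w j i₀ ^ 2 := fun j => by ring
            simp_rw [this]
            rw [← Finset.mul_sum, hsum, hv]
            field_simp
    · refine le_add_of_nonneg_of_le (Real.exp_pos _).le ?_
      refine (Finset.prod_le_one (fun _ _ => norm_nonneg _)
        fun j _ => norm_charFun_colMass_le_one hk b (w j) v).trans ?_
      have h2 : (tau k * (k : ℝ) ^ 2) ^ 2 * u ^ 2 = (|v| * (tau k * W)) ^ 2 := by
        rw [mul_pow |v|, sq_abs, hv]
        field_simp
      rw [h2]
      exact one_le_pow₀ h1.le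
  have := sum_abs_sub_le_of_charFun (q := fun y : Fin R → Fin k → Bool => ∏ j, colMass k b (y j))
    (fun y => Finset.prod_nonneg fun j _ => hmass.1 _) _ (by positivity) key
    (c / (W / (k : ℝ) ^ 2))
  have hset : ∀ y : Fin R → Fin k → Bool,
      |(∑ j, ∑ i, w j i * bit (y j i)) / (W / (k : ℝ) ^ 2) - c / (W / (k : ℝ) ^ 2)| ≤ 1 ↔
      |(∑ j, ∑ i, w j i * bit (y j i)) - c| ≤ W / (k : ℝ) ^ 2 := by
    intro y
    rw [← sub_div, abs_div, abs_of_pos hl, div_le_one hl]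
  simp_rw [hset] at this
  refine this.trans ?_
  have h1 : 1 / √(1 + 2 * ((k : ℝ) ^ 2 / 20)) ≤ 5 / k := by
    rw [div_le_div_iff₀ (by positivity) hk0, one_mul, ← div_le_iff₀' (by norm_num)]
    refine Real.le_sqrt_of_sq_le ?_
    nlinarith [sq_nonneg (k : ℝ)]
  have h2 : (tau k * (k : ℝ) ^ 2) ^ 2 ≤ 1 / k := by
    have : (tau k * (k : ℝ) ^ 2) ^ 2 = 1 / (k : ℝ) ^ 10 := by unfold tau; field_simp
    rw [this]
    gcongr
    exact le_self_pow₀ hk1 (by norm_num)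
  calc _ ≤ 2 * (5 / (k : ℝ) + 1 / k) := by gcongr
    _ = 12 / k := by ring

/-! ### Halfspaces that are regular outside of disjoint sets -/

/-- The linear form `∑ w i j y i j`, in terms of the columns of `y`. -/
def linForm {k R : ℕ} (w : Fin k → Fin R → ℝ) (y : Fin R → Fin k → Bool) : ℝ :=
  ∑ j, ∑ i, w i j * bit (y j i)

/-- Probability that the halfspace accepts, given that the columns are drawn from `𝒟_b`. -/
def accept {k R : ℕ} (b : Bool) (w : Fin k → Fin R → ℝ) (θ : ℝ) : ℝ :=
  ∑ y : Fin R → Fin k → Bool, (∏ j, colMass k b (y j)) * if 0 ≤ linForm w y - θ then 1 else 0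

theorem prod_colMass_isProbMass {k : ℕ} (hk : 12 ^ 6 ≤ k) (R : ℕ) (b : Bool) :
    IsProbMass (fun y : Fin R → Fin k → Bool => ∏ j, colMass k b (y j)) := by
  refine ⟨fun y => Finset.prod_nonneg fun j _ => (colMass_isProbMass hk b).1 _, ?_⟩
  rw [← Fintype.prod_sum (fun (_ : Fin R) (c : Fin k → Bool) => colMass k b c)]
  exact Finset.prod_eq_one fun j _ => (colMass_isProbMass hk b).2

/-- The coefficients outside of the sets `H i`. -/
def offSet {k R : ℕ} (H : Fin k → Finset (Fin R)) (w : Fin k → Fin R → ℝ) (i : Fin k)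
    (j : Fin R) : ℝ :=
  if j ∈ H i then 0 else w i j

theorem abs_prodExp_colMass_sub_le {k : ℕ} (hk : 12 ^ 6 ≤ k) {R : ℕ} {M : ℝ} (hM : 0 ≤ M)
    (w : Fin k → Fin R → ℝ) {H : Fin k → Finset (Fin R)}
    (hH : ∀ i i', i ≠ i' → Disjoint (H i) (H i')) {φ : ℝ → ℝ} (hφ : HasCubicApprox M φ) (c : ℝ) :
    |prodExp (fun _ => colMass k true) (fun j z => ∑ i, w i j * bit (z i)) φ c
      - prodExp (fun _ => colMass k false) (fun j z => ∑ i, w i j * bit (z i)) φ c|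
      ≤ ∑ j, 2 * (M * (∑ i, |offSet H w i j|) ^ 4) := by
  refine abs_prodExp_sub_le (fun _ => colMass_isProbMass hk _) (fun _ => colMass_isProbMass hk _)
    _ _ (fun j φ hφ c => ?_) hφ c
  have hex : ∃ (i₀ : Fin k) (a : ℝ), ∀ z : Fin k → Bool, ∑ i, w i j * bit (z i)
      = a * bit (z i₀) + ∑ i, offSet H w i j * bit (z i) := by
    by_cases h : ∃ i, j ∈ H i
    · obtain ⟨i₀, hi₀⟩ := h
      refine ⟨i₀, w i₀ j, fun z => ?_⟩
      rw [← Finset.add_sum_erase _ _ (Finset.mem_univ i₀),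
        ← Finset.add_sum_erase _ (fun i => offSet H w i j * bit (z i)) (Finset.mem_univ i₀)]
      simp only [offSet, hi₀, if_true, zero_mul, zero_add]
      congr 1
      refine Finset.sum_congr rfl fun i hi => ?_
      rw [if_neg fun h => Finset.disjoint_left.1 (hH i i₀ (Finset.ne_of_mem_erase hi)) h hi₀]
    · push Not at h
      refine ⟨⟨0, lt_of_lt_of_le (by norm_num) hk⟩, 0, fun z => ?_⟩
      simp [offSet, h]
  obtain ⟨i₀, a, h⟩ := hex
  simp_rw [h]
  exact abs_colMass_sub_le hk hφ hM c a _ i₀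

theorem sum_pow_four_le {k R : ℕ} {v : Fin k → Fin R → ℝ} {W t : ℝ}
    (hsum : ∀ i, ∑ j, v i j ^ 2 ≤ W) (hW : 0 ≤ W) (ht : 0 ≤ t)
    (hmax : ∀ i j, v i j ^ 2 ≤ t * W) :
    ∑ j, (∑ i, |v i j|) ^ 4 ≤ (k : ℝ) ^ 4 * (t * W ^ 2) := by
  have h1 : ∀ j, (∑ i, |v i j|) ^ 4 ≤ (k : ℝ) ^ 3 * ∑ i, (v i j ^ 2) ^ 2 := by
    intro j
    have h2 : (∑ i, |v i j|) ^ 2 ≤ k * ∑ i, v i j ^ 2 := by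
      simpa using sq_sum_le_card_mul_sum_sq (s := Finset.univ) (f := fun i => |v i j|)
    have h3 : (∑ i, v i j ^ 2) ^ 2 ≤ k * ∑ i, (v i j ^ 2) ^ 2 := by
      simpa using sq_sum_le_card_mul_sum_sq (s := Finset.univ) (f := fun i => v i j ^ 2)
    calc (∑ i, |v i j|) ^ 4 = ((∑ i, |v i j|) ^ 2) ^ 2 := by ring
      _ ≤ (k * ∑ i, v i j ^ 2) ^ 2 := by gcongr
      _ = (k : ℝ) ^ 2 * (∑ i, v i j ^ 2) ^ 2 := by ring
      _ ≤ (k : ℝ) ^ 2 * (k * ∑ i, (v i j ^ 2) ^ 2) := by gcongr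
      _ = _ := by ring
  have h4 : ∀ i, ∑ j, (v i j ^ 2) ^ 2 ≤ t * W ^ 2 := by
    intro i
    calc ∑ j, (v i j ^ 2) ^ 2 ≤ ∑ j, t * W * v i j ^ 2 := by
          refine Finset.sum_le_sum fun j _ => ?_
          rw [sq]
          exact mul_le_mul_of_nonneg_right (hmax i j) (sq_nonneg _)
      _ = t * W * ∑ j, v i j ^ 2 := by rw [Finset.mul_sum]
      _ ≤ t * W * W := by
          refine mul_le_mul_of_nonneg_left (hsum i) (by positivity)
      _ = _ := by ring
  calc ∑ j, (∑ i, |v i j|) ^ 4 ≤ ∑ j, (k : ℝ) ^ 3 * ∑ i, (v i j ^ 2) ^ 2 :=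
        Finset.sum_le_sum fun j _ => h1 j
    _ = (k : ℝ) ^ 3 * ∑ i, ∑ j, (v i j ^ 2) ^ 2 := by rw [← Finset.mul_sum, Finset.sum_comm]
    _ ≤ (k : ℝ) ^ 3 * ∑ _i : Fin k, t * W ^ 2 := by
        gcongr with i
        exact h4 i
    _ = _ := by
        simp only [Finset.sum_const, Finset.card_univ, Fintype.card_fin, nsmul_eq_mul]
        ring

theorem exists_gap {Y : Type*} [Fintype Y] (f : Y → ℝ) :
    ∃ l : ℝ, 0 < l ∧ ∀ y, f y < 0 → f y ≤ -l := by
  classical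
  rcases (Finset.univ.filter fun y => f y < 0).eq_empty_or_nonempty with h | h
  · refine ⟨1, one_pos, fun y hy => ?_⟩
    have : y ∈ Finset.univ.filter fun y => f y < 0 := by simpa using hy
    simp [h] at this
  · obtain ⟨m, hm, hmax⟩ := Finset.exists_max_image _ f h
    refine ⟨-f m, by simpa using hm, fun y hy => ?_⟩
    rw [neg_neg]
    exact hmax y (by simpa using hy)

theorem accept_le_of_regular : ∃ C : ℝ, ∀ {k R : ℕ}, 12 ^ 6 ≤ k → ∀ (w : Fin k → Fin R → ℝ) (θ : ℝ)
    (H : Fin k → Finset (Fin R)), (∀ i i', i ≠ i' → Disjoint (H i) (H i')) →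
    (∀ i, ∀ j ∉ H i, w i j ^ 2 ≤ tau k ^ 2 * ∑ j ∈ (H i)ᶜ, w i j ^ 2) →
    accept true w θ ≤ accept false w θ + C / k := by
  obtain ⟨K, hK, hstep⟩ := exists_smooth_step
  refine ⟨12 + 2 * K, fun {k R} hk w θ H hH hreg => ?_⟩
  have hkpos : 0 < k := lt_of_lt_of_le (by norm_num) hk
  have hk0 : (0 : ℝ) < k := by exact_mod_cast hkpos
  have hk1 : (1 : ℝ) ≤ k := by exact_mod_cast hkpos
  have ht : 0 < tau k := by unfold tau; positivity
  have hoff : ∀ i, ∑ j, offSet H w i j ^ 2 = ∑ j ∈ (H i)ᶜ, w i j ^ 2 := by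
    intro i
    have : ∀ j, offSet H w i j ^ 2 = if j ∈ (H i)ᶜ then w i j ^ 2 else 0 := by
      intro j
      by_cases hj : j ∈ H i <;> simp [offSet, hj]
    simp_rw [this]
    rw [Finset.sum_ite_mem, Finset.univ_inter]
  have : Nonempty (Fin k) := ⟨⟨0, hkpos⟩⟩
  obtain ⟨i₀, hi₀⟩ := Finite.exists_max fun i => ∑ j ∈ (H i)ᶜ, w i j ^ 2
  set V := ∑ j ∈ (H i₀)ᶜ, w i₀ j ^ 2 with hV
  have hV0 : 0 ≤ V := Finset.sum_nonneg fun j _ => sq_nonneg _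
  have hmax : ∀ i j, offSet H w i j ^ 2 ≤ tau k ^ 2 * V := by
    intro i j
    by_cases hj : j ∈ H i
    · rw [offSet, if_pos hj, zero_pow two_ne_zero]
      positivity
    · simp only [offSet, hj, if_false]
      exact (hreg i j hj).trans (mul_le_mul_of_nonneg_left (hi₀ i) (by positivity))
  have herr := sum_pow_four_le (v := offSet H w) (fun i => (hoff i).trans_le (hi₀ i)) hV0
    (by positivity : 0 ≤ tau k ^ 2) hmax
  obtain ⟨l, hl, hlV, hwin⟩ : ∃ l : ℝ, 0 < l ∧ V ^ 2 ≤ l ^ 4 * (k : ℝ) ^ 8 ∧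
      ∑ y : Fin R → Fin k → Bool with -l < linForm w y - θ ∧ linForm w y - θ < 0,
        ∏ j, colMass k false (y j) ≤ 12 / k := by
    rcases hV0.eq_or_lt with h0 | hpos
    · obtain ⟨l, hl, hgap⟩ := exists_gap fun y : Fin R → Fin k → Bool => linForm w y - θ
      refine ⟨l, hl, by rw [← h0, zero_pow two_ne_zero]; positivity, ?_⟩
      rw [Finset.filter_false_of_mem]
      · simp only [Finset.sum_empty]
        positivity
      · intro y _ hy
        linarith [hgap y hy.2]
    · refine ⟨√V / (k : ℝ) ^ 2, by positivity, le_of_eq ?_, ?_⟩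
      · have : √V ^ 4 = V ^ 2 := by
          rw [show √V ^ 4 = (√V ^ 2) ^ 2 by ring, Real.sq_sqrt hV0]
        rw [div_pow, this]
        field_simp
      · refine le_trans (Finset.sum_le_sum_of_subset_of_nonneg (fun y hy => ?_)
          fun y _ _ => (prod_colMass_isProbMass hk R false).1 y)
          (small_ball_of_regular hk false (fun j i => w i j) i₀ (H i₀) (W := √V)
            (Real.sqrt_pos.2 hpos) (by rw [Real.sq_sqrt hV0]) (fun j hj => ?_) θ)
        · simp only [Finset.mem_filter, Finset.mem_univ, true_and] at hy ⊢
          exact abs_le.2 ⟨hy.1.le, hy.2.le.trans (by positivity)⟩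
        · refine abs_le_of_sq_le_sq ?_ (by positivity)
          rw [mul_pow, Real.sq_sqrt hV0]
          exact hreg i₀ j hj
  obtain ⟨Ψ, hΨ, hΨ0, hΨ1, hΨpos, hΨneg⟩ := hstep l hl
  have hP : ∀ b, prodExp (fun _ : Fin R => colMass k b) (fun j z => ∑ i, w i j * bit (z i)) Ψ (-θ)
      = ∑ y : Fin R → Fin k → Bool, (∏ j, colMass k b (y j)) * Ψ (linForm w y - θ) := by
    intro b
    refine Finset.sum_congr rfl fun y _ => ?_
    rw [linForm, neg_add_eq_sub]
  have h1 : accept true w θ ≤ ∑ y : Fin R → Fin k → Bool,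
      (∏ j, colMass k true (y j)) * Ψ (linForm w y - θ) := by
    refine Finset.sum_le_sum fun y _ => mul_le_mul_of_nonneg_left ?_
      ((prod_colMass_isProbMass hk R true).1 y)
    split_ifs with h
    · rw [hΨpos _ h]
    · exact hΨ0 _
  have h2 : ∑ y : Fin R → Fin k → Bool, (∏ j, colMass k false (y j)) * Ψ (linForm w y - θ)
      ≤ accept false w θ + 12 / k := by
    refine le_trans ?_ (add_le_add_right hwin _)
    rw [Finset.sum_filter, accept, ← Finset.sum_add_distrib]
    refine Finset.sum_le_sum fun y _ => ?_
    have hy := (prod_colMass_isProbMass hk R false).1 y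
    rcases le_or_gt 0 (linForm w y - θ) with h | h
    · rw [if_pos h, hΨpos _ h]
      refine le_add_of_nonneg_right ?_
      split_ifs
      · exact hy
      · exact le_rfl
    · rw [if_neg h.not_ge, mul_zero, zero_add]
      rcases lt_or_ge (-l) (linForm w y - θ) with h' | h'
      · rw [if_pos ⟨h', h⟩]
        exact mul_le_of_le_one_right hy (hΨ1 _)
      · rw [hΨneg _ h', if_neg fun hh => h'.not_gt hh.1, mul_zero]
  have h3 := abs_prodExp_colMass_sub_le hk (by positivity : 0 ≤ K / l ^ 4) w hH hΨ (-θ)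
  rw [hP, hP] at h3
  have h4 : ∑ j, 2 * (K / l ^ 4 * (∑ i, |offSet H w i j|) ^ 4) ≤ 2 * K / k := by
    rw [← Finset.mul_sum, ← Finset.mul_sum]
    calc 2 * (K / l ^ 4 * ∑ j, (∑ i, |offSet H w i j|) ^ 4)
        ≤ 2 * (K / l ^ 4 * ((k : ℝ) ^ 4 * (tau k ^ 2 * (l ^ 4 * (k : ℝ) ^ 8)))) := by
          gcongr
          exact herr.trans (by gcongr)
      _ = 2 * K / (k : ℝ) ^ 2 := by unfold tau; field_simp
      _ ≤ 2 * K / k := by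
          gcongr
          exact le_self_pow₀ hk1 (by norm_num)
  have h5 := (abs_le.1 h3).2
  have h6 : (12 + 2 * K) / (k : ℝ) = 12 / k + 2 * K / k := add_div _ _ _
  linarith

/-! ### Truncation of irregular rows -/

theorem prod_colMass_eq {k R : ℕ} (b : Bool) (y : Fin R → Fin k → Bool) :
    ∏ j, colMass k b (y j) = ∑ x : Fin R → Fin k → Bool,
      (∏ j, D k b (x j)) * ∏ j, ∏ i, noiseMass k (x j i) (y j i) := by
  unfold colMass
  rw [Finset.prod_univ_sum]
  simp only [Fintype.piFinset_univ, Finset.prod_mul_distrib]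

theorem bit_sub_bit_mem (c d : Bool) :
    bit c - bit d = -1 ∨ bit c - bit d = 0 ∨ bit c - bit d = 1 := by
  cases c <;> cases d <;> simp [bit]

theorem bit_injective : Function.Injective bit := by
  intro c d h
  cases c <;> cases d <;> simp_all [bit]

/-- Two bit matrices differing only along a chain of rapidly decreasing coefficients give
separated values of the linear form. -/
theorem eq_of_abs_linForm_sub_le {k R s : ℕ} {u : Fin k → Fin R → ℝ} {i : Fin k} {e : ℕ → Fin R}
    (he : Set.InjOn e (Finset.range s)) (hchain : ∀ l, l + 1 < s → 3 * |u i (e (l + 1))| ≤ |u i (e l)|)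
    {δ : ℝ} (hδ : 4 * δ < |u i (e (s - 1))|) {y y' : Fin R → Fin k → Bool}
    (hy : |linForm u y - linForm u y'| ≤ 2 * δ)
    (hoff : ∀ j i', (∀ l < s, (j, i') ≠ (e l, i)) → y j i' = y' j i') : y = y' := by
  by_contra hne
  have hex : ∃ l < s, bit (y (e l) i) - bit (y' (e l) i) ≠ 0 := by
    by_contra! h
    refine hne (funext fun j => funext fun i' => ?_)
    by_cases hji : ∀ l < s, (j, i') ≠ (e l, i)
    · exact hoff j i' hji
    · push Not at hji
      obtain ⟨l, hl, heq⟩ := hji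
      rw [Prod.mk.injEq] at heq
      rw [heq.1, heq.2]
      exact bit_injective (sub_eq_zero.1 (h l hl))
  have hsum : linForm u y - linForm u y'
      = ∑ l ∈ Finset.range s, u i (e l) * (bit (y (e l) i) - bit (y' (e l) i)) := by
    have h1 : linForm u y - linForm u y'
        = ∑ j, ∑ i', u i' j * (bit (y j i') - bit (y' j i')) := by
      simp_rw [linForm, ← Finset.sum_sub_distrib, mul_sub]
    have h2 : ∀ j, ∑ i', u i' j * (bit (y j i') - bit (y' j i'))
        = u i j * (bit (y j i) - bit (y' j i)) := by
      intro j
      refine Finset.sum_eq_single i (fun i' _ hi' => ?_) (by simp)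
      rw [hoff j i' fun l _ h => hi' (Prod.mk.inj h).2, sub_self, mul_zero]
    simp_rw [h1, h2]
    rw [← Finset.sum_image (f := fun j => u i j * (bit (y j i) - bit (y' j i))) he]
    refine (Finset.sum_subset (Finset.subset_univ _) fun j _ hj => ?_).symm
    rw [hoff j i fun l hl h => hj ?_, sub_self, mul_zero]
    exact Finset.mem_image.2 ⟨l, Finset.mem_range.2 hl, (Prod.mk.inj h).1.symm⟩
  have := abs_sum_ge_of_chain (a := fun l => u i (e l)) hchain (fun l => bit_sub_bit_mem _ _) hex
  rw [← hsum] at this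
  linarith

theorem window_le_of_chain {k : ℕ} (hk : 12 ^ 6 ≤ k) {R s : ℕ} (b : Bool) {u : Fin k → Fin R → ℝ}
    {i : Fin k} {e : ℕ → Fin R} (he : Set.InjOn e (Finset.range s))
    (hchain : ∀ l, l + 1 < s → 3 * |u i (e (l + 1))| ≤ |u i (e l)|)
    {δ : ℝ} (hδ : 4 * δ < |u i (e (s - 1))|) (θ : ℝ) :
    ∑ y : Fin R → Fin k → Bool with |linForm u y - θ| ≤ δ, ∏ j, colMass k b (y j)
      ≤ (1 - 1 / (k : ℝ) ^ 2 / 2) ^ s := by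
  classical
  have hcond : ∀ x : Fin R → Fin k → Bool, ∑ y : Fin R → Fin k → Bool with |linForm u y - θ| ≤ δ,
      ∏ j, ∏ i, noiseMass k (x j i) (y j i) ≤ (1 - 1 / (k : ℝ) ^ 2 / 2) ^ s := by
    intro x
    set E : Finset (Fin R × Fin k) := (Finset.range s).image fun l => (e l, i) with hE
    have hcard : E.card = s := by
      rw [hE, Finset.card_image_of_injOn, Finset.card_range]
      intro l hl l' hl' h
      exact he hl hl' (Prod.mk.inj h).1
    have := sum_prod_le_pow_card (n := fun p : Fin R × Fin k => noiseMass k (x p.1 p.2))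
      (fun p => noiseMass_isProbMass hk _) (fun p => noiseMass_le hk _) E
      (Finset.univ.filter fun y => |linForm u (fun j i => y (j, i)) - θ| ≤ δ) (by
        intro y hy y' hy' hoff
        simp only [Finset.mem_filter, Finset.mem_univ, true_and] at hy hy'
        have heq := eq_of_abs_linForm_sub_le he hchain hδ
          (y := fun j i => y (j, i)) (y' := fun j i => y' (j, i)) (by
            have h1 := abs_le.1 hy
            have h2 := abs_le.1 hy'
            exact abs_le.2 ⟨by linarith [h1.1, h2.2], by linarith [h1.2, h2.1]⟩)
          (fun j i' h => hoff _ fun hmem => by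
            obtain ⟨l, hl, hl'⟩ := Finset.mem_image.1 hmem
            exact h l (Finset.mem_range.1 hl) hl'.symm)
        funext p
        exact congrFun (congrFun heq p.1) p.2)
    rw [hcard] at this
    refine le_trans (le_of_eq ?_) this
    rw [Finset.sum_filter, Finset.sum_filter,
      ← (Equiv.curry (Fin R) (Fin k) Bool).sum_comp]
    refine Finset.sum_congr rfl fun y _ => ?_
    simp only [Equiv.curry_apply, Fintype.prod_prod_type]
    rfl
  have hD : ∀ x : Fin R → Fin k → Bool, 0 ≤ ∏ j, D k b (x j) :=
    fun x => Finset.prod_nonneg fun j _ => (D_isProbMass hk b).1 _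
  simp_rw [prod_colMass_eq]
  rw [Finset.sum_comm]
  simp_rw [← Finset.mul_sum]
  calc _ ≤ ∑ x : Fin R → Fin k → Bool, (∏ j, D k b (x j)) * (1 - 1 / (k : ℝ) ^ 2 / 2) ^ s :=
        Finset.sum_le_sum fun x _ => mul_le_mul_of_nonneg_left (hcond x) (hD x)
    _ = (1 - 1 / (k : ℝ) ^ 2 / 2) ^ s := by
        rw [← Finset.sum_mul, ← Fintype.prod_sum (fun (_ : Fin R) (c : Fin k → Bool) => D k b c),
          Finset.prod_eq_one fun j _ => (D_isProbMass hk b).2, one_mul]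

theorem one_sub_noise_pow_le {k : ℕ} (hk : 12 ^ 6 ≤ k) :
    (1 - 1 / (k : ℝ) ^ 2 / 2) ^ ⌈4 * (k : ℝ) ^ 2 * Real.log k⌉₊ ≤ 1 / k := by
  have hkpos : 0 < k := lt_of_lt_of_le (by norm_num) hk
  have hk0 : (0 : ℝ) < k := by exact_mod_cast hkpos
  have hk1 : (1 : ℝ) ≤ k := by exact_mod_cast hkpos
  have hlog : 0 ≤ Real.log k := Real.log_nonneg hk1
  have hrate := noiseRate_le_one hk
  calc (1 - 1 / (k : ℝ) ^ 2 / 2) ^ ⌈4 * (k : ℝ) ^ 2 * Real.log k⌉₊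
      ≤ Real.exp (-(1 / (k : ℝ) ^ 2 / 2)) ^ ⌈4 * (k : ℝ) ^ 2 * Real.log k⌉₊ := by
        refine pow_le_pow_left₀ (by linarith) ?_ _
        linarith [Real.add_one_le_exp (-(1 / (k : ℝ) ^ 2 / 2))]
    _ = Real.exp (-(⌈4 * (k : ℝ) ^ 2 * Real.log k⌉₊ * (1 / (k : ℝ) ^ 2 / 2))) := by
        rw [← Real.exp_nat_mul, mul_neg]
    _ ≤ Real.exp (-Real.log k) := by
        refine Real.exp_le_exp.2 (neg_le_neg ?_)
        calc Real.log k ≤ 2 * Real.log k := by linarith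
          _ = 4 * (k : ℝ) ^ 2 * Real.log k * (1 / (k : ℝ) ^ 2 / 2) := by field_simp; ring
          _ ≤ _ := by gcongr; exact Nat.le_ceil _
    _ = 1 / k := by rw [Real.exp_neg, Real.exp_log hk0, one_div]

/-- `u` is either `w`, or a truncation of `w` which has a chain of rapidly decreasing
coefficients and whose `ℓ¹` distance to `w` is small. -/
def IsTruncation {R : ℕ} (k : ℕ) (w u : Fin R → ℝ) : Prop :=
  u = w ∨ ∃ e : ℕ → Fin R, Set.InjOn e (Finset.range ⌈4 * (k : ℝ) ^ 2 * Real.log k⌉₊) ∧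
    (∀ l, l + 1 < ⌈4 * (k : ℝ) ^ 2 * Real.log k⌉₊ → 3 * |u (e (l + 1))| ≤ |u (e l)|) ∧
    4 * (k * ∑ j, |w j - u j|) < |u (e (⌈4 * (k : ℝ) ^ 2 * Real.log k⌉₊ - 1))|

theorem abs_accept_sub_le {k : ℕ} (hk : 12 ^ 6 ≤ k) {R : ℕ} (b : Bool) {w u : Fin k → Fin R → ℝ}
    (h : ∀ i, IsTruncation k (w i) (u i)) (θ : ℝ) :
    |accept b w θ - accept b u θ| ≤ 1 / k := by
  have hkpos : 0 < k := lt_of_lt_of_le (by norm_num) hk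
  have : Nonempty (Fin k) := ⟨⟨0, hkpos⟩⟩
  obtain ⟨i, hi⟩ := Finite.exists_max fun i => ∑ j, |w i j - u i j|
  rcases h i with heq | ⟨e, he, hchain, hδ⟩
  · have hwu : w = u := by
      funext i' j
      have h1 := hi i'
      rw [heq] at h1
      simp only [sub_self, abs_zero, Finset.sum_const_zero] at h1
      have h2 := (Finset.single_le_sum (f := fun j => |w i' j - u i' j|)
        (fun _ _ => abs_nonneg _) (Finset.mem_univ j)).trans h1
      exact sub_eq_zero.1 (abs_nonpos_iff.1 h2)
    rw [hwu, sub_self, abs_zero]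
    positivity
  · refine le_trans ?_ ((window_le_of_chain hk b he hchain hδ θ).trans (one_sub_noise_pow_le hk))
    have hdist : ∀ y, |linForm w y - linForm u y| ≤ k * ∑ j, |w i j - u i j| := by
      intro y
      have h1 : linForm w y - linForm u y = ∑ i, ∑ j, (w i j - u i j) * bit (y j i) := by
        rw [Finset.sum_comm]
        simp_rw [linForm, ← Finset.sum_sub_distrib, sub_mul]
      rw [h1]
      calc _ ≤ ∑ i, ∑ j, |(w i j - u i j) * bit (y j i)| :=
            (Finset.abs_sum_le_sum_abs _ _).trans
              (Finset.sum_le_sum fun i _ => Finset.abs_sum_le_sum_abs _ _)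
        _ ≤ ∑ i, ∑ j, |w i j - u i j| := by
            refine Finset.sum_le_sum fun i _ => Finset.sum_le_sum fun j _ => ?_
            cases y j i <;> simp [bit]
        _ ≤ ∑ _i : Fin k, ∑ j, |w i j - u i j| := Finset.sum_le_sum fun i' _ => hi i'
        _ = _ := by simp
    rw [accept, accept, ← Finset.sum_sub_distrib, Finset.sum_filter]
    refine (Finset.abs_sum_le_sum_abs _ _).trans (Finset.sum_le_sum fun y _ => ?_)
    have hy := (prod_colMass_isProbMass hk R b).1 y
    simp only at hy
    rw [← mul_sub, abs_mul, abs_of_nonneg hy]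
    have hd := abs_le.1 (hdist y)
    by_cases hwin : |linForm u y - θ| ≤ k * ∑ j, |w i j - u i j|
    · rw [if_pos hwin]
      refine mul_le_of_le_one_right hy ?_
      split_ifs <;> simp
    · have hiff : 0 ≤ linForm w y - θ ↔ 0 ≤ linForm u y - θ := by
        rw [not_le, lt_abs] at hwin
        constructor <;> intro h0 <;> rcases hwin with h1 | h1 <;> linarith [hd.1, hd.2]
      simp only [hiff, sub_self, abs_zero, mul_zero, if_neg hwin, le_refl]

/-! ### Critical indices -/

/-- Enumeration of a finite set by decreasing values of `f`. -/
theorem exists_antitone_enumeration {α : Type*} [Nonempty α] (B : Finset α) (f : α → ℝ) :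
    ∃ e : ℕ → α, Set.InjOn e (Finset.range B.card) ∧ (∀ n < B.card, e n ∈ B) ∧
      (∀ x ∈ B, ∃ n < B.card, e n = x) ∧ ∀ a b, a ≤ b → b < B.card → f (e b) ≤ f (e a) := by
  set g : Fin B.card → B := fun n => B.equivFin.symm n
  set σ := Tuple.sort fun n => -f (g n)
  have hmono : Monotone ((fun n => -f (g n)) ∘ σ) := Tuple.monotone_sort _
  have hval : ∀ n (hn : n < B.card), (if h : n < B.card then (g (σ ⟨n, h⟩) : α)
      else Classical.arbitrary α) = g (σ ⟨n, hn⟩) := fun n hn => dif_pos hn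
  refine ⟨fun n => if h : n < B.card then g (σ ⟨n, h⟩) else Classical.arbitrary α, ?_, ?_, ?_, ?_⟩
  · intro n hn m hm h
    rw [Finset.mem_coe, Finset.mem_range] at hn hm
    simp only [hval n hn, hval m hm] at h
    have h2 := σ.injective (B.equivFin.symm.injective (Subtype.ext h))
    exact congrArg Fin.val h2
  · intro n hn
    simp only [hval n hn]
    exact (g _).2
  · intro x hx
    refine ⟨σ.symm (B.equivFin ⟨x, hx⟩), (σ.symm _).2, ?_⟩
    simp only [hval _ (σ.symm (B.equivFin ⟨x, hx⟩)).2]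
    simp [g]
  · intro a b hab hb
    simp only [hval b hb, hval a (hab.trans_lt hb)]
    have := hmono (show (⟨a, hab.trans_lt hb⟩ : Fin B.card) ≤ ⟨b, hb⟩ from hab)
    simpa using this

theorem tau_pos {k : ℕ} (hk : 12 ^ 6 ≤ k) : 0 < tau k := by
  have hk0 : (0 : ℝ) < k := by exact_mod_cast lt_of_lt_of_le (by norm_num) hk
  unfold tau
  positivity

theorem sq_mul_tau_lt {k : ℕ} (hk : 12 ^ 6 ≤ k) : 16 * (k : ℝ) ^ 2 * tau k < 1 := by
  have hk' : (12 ^ 6 : ℝ) ≤ k := by exact_mod_cast hk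
  have hk0 : (0 : ℝ) < k := lt_of_lt_of_le (by norm_num) hk'
  have h1 : (1 : ℝ) ≤ k := le_trans (by norm_num) hk'
  have h2 : (k : ℝ) ≤ (k : ℝ) ^ 5 := le_self_pow₀ h1 (by norm_num)
  have h3 : 16 * (k : ℝ) ^ 2 * tau k = 16 / (k : ℝ) ^ 5 := by unfold tau; field_simp
  rw [h3, div_lt_one (by positivity)]
  linarith

theorem tau_le {k : ℕ} (hk : 12 ^ 6 ≤ k) : tau k ≤ 1 / 16 := by
  have h1 := sq_mul_tau_lt hk
  have hk1 : (1 : ℝ) ≤ k := by exact_mod_cast le_trans (by norm_num) hk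
  have h2 : (1 : ℝ) ≤ (k : ℝ) ^ 2 := one_le_pow₀ hk1
  nlinarith [tau_pos hk]

/-- If no prefix of the largest coordinates leaves a regular remainder, the remaining weights
decrease geometrically. -/
theorem remainder_decay {τ : ℝ} {S : ℕ → ℝ} {T : ℕ}
    (hS : ∀ n, 0 ≤ S n) (hstep : ∀ n < T, S (n + 1) ≤ (1 - τ ^ 2) * S n)
    {n m : ℕ} (hnm : n + m ≤ T) : S (n + m) ≤ Real.exp (-(τ ^ 2 * m)) * S n := by
  induction m with
  | zero => simp
  | succ m ih =>
    have h1 := ih (by omega)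
    have h2 := hstep (n + m) (by omega)
    have h3 : 1 - τ ^ 2 ≤ Real.exp (-τ ^ 2) := by linarith [Real.add_one_le_exp (-τ ^ 2)]
    calc S (n + (m + 1)) ≤ (1 - τ ^ 2) * S (n + m) := h2
      _ ≤ Real.exp (-τ ^ 2) * (Real.exp (-(τ ^ 2 * m)) * S n) :=
          mul_le_mul h3 h1 (hS _) (Real.exp_pos _).le
      _ = Real.exp (-(τ ^ 2 * (m + 1 : ℕ))) * S n := by
          rw [← mul_assoc, ← Real.exp_add]
          congr 2
          push_cast
          ring

theorem exists_truncation {k : ℕ} (hk : 12 ^ 6 ≤ k) {R : ℕ} (hR : 0 < R) {w : Fin R → ℝ}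
    {B : Finset (Fin R)} (hB : IsTopSet (topSize k R) w B) :
    ∃ (u : Fin R → ℝ) (H : Finset (Fin R)), H ⊆ B ∧
      (∀ j ∉ H, u j ^ 2 ≤ tau k ^ 2 * ∑ j ∈ Hᶜ, u j ^ 2) ∧ IsTruncation k w u := by
  have : Nonempty (Fin R) := ⟨⟨0, hR⟩⟩
  obtain ⟨e, heinj, heB, hesurj, heanti⟩ := exists_antitone_enumeration B fun j => |w j|
  set T := B.card with hT
  set H : ℕ → Finset (Fin R) := fun n => (Finset.range n).image e with hH
  have hHB : ∀ n ≤ T, H n ⊆ B := by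
    intro n hn j hj
    obtain ⟨l, hl, rfl⟩ := Finset.mem_image.1 hj
    exact heB l ((Finset.mem_range.1 hl).trans_le hn)
  by_cases hreg : ∃ n ≤ T, ∀ j ∉ H n, w j ^ 2 ≤ tau k ^ 2 * ∑ j ∈ (H n)ᶜ, w j ^ 2
  · obtain ⟨n, hn, h⟩ := hreg
    exact ⟨w, H n, hHB n hn, h, Or.inl rfl⟩
  push Not at hreg
  have hHT : H T = B := by
    refine (hHB T le_rfl).antisymm fun x hx => ?_
    obtain ⟨n, hn, rfl⟩ := hesurj x hx
    exact Finset.mem_image_of_mem e (Finset.mem_range.2 hn)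
  have hTfloor : T = ⌊topSize k R⌋₊ := by
    obtain ⟨j, hj, -⟩ := hreg T le_rfl
    rw [hHT] at hj
    have h1 : T < R := by
      have := Finset.card_lt_univ_of_notMem hj
      simpa using this
    have := hB.1
    omega
  set S : ℕ → ℝ := fun n => ∑ j ∈ (H n)ᶜ, w j ^ 2 with hS
  have hS0 : ∀ n, 0 ≤ S n := fun n => Finset.sum_nonneg fun _ _ => sq_nonneg _
  have henot : ∀ n < T, e n ∉ H n := by
    intro n hn h
    obtain ⟨l, hl, hle⟩ := Finset.mem_image.1 h
    rw [Finset.mem_range] at hl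
    have := heinj (by simpa using hl.trans hn) (by simpa using hn) hle
    omega
  have hlarge : ∀ n < T, tau k ^ 2 * S n < w (e n) ^ 2 := by
    intro n hn
    obtain ⟨j, hj, hlt⟩ := hreg n hn.le
    refine hlt.trans_le (sq_le_sq.2 ?_)
    by_cases hjB : j ∈ B
    · obtain ⟨l, hl, rfl⟩ := hesurj j hjB
      refine heanti n l ?_ hl
      by_contra hln
      exact hj (Finset.mem_image_of_mem e (Finset.mem_range.2 (not_le.1 hln)))
    · exact hB.2 _ (heB n hn) j hjB
  have hSsucc : ∀ n < T, S n = w (e n) ^ 2 + S (n + 1) := by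
    intro n hn
    have : (H n)ᶜ = insert (e n) (H (n + 1))ᶜ := by
      rw [hH]
      simp only [Finset.range_add_one, Finset.image_insert, Finset.compl_insert]
      rw [Finset.insert_erase (Finset.mem_compl.2 (henot n hn))]
    simp only [hS, this]
    rw [Finset.sum_insert]
    rw [Finset.mem_compl, not_not]
    exact Finset.mem_image_of_mem e (Finset.self_mem_range_succ n)
  have hsmall : ∀ n < T, w (e n) ^ 2 ≤ S n := fun n hn => by
    linarith [hSsucc n hn, hS0 (n + 1)]
  have hτ0 := tau_pos hk
  have hτ16 := tau_le hk
  have hdecay : ∀ {n m : ℕ}, n + m ≤ T → S (n + m) ≤ Real.exp (-(tau k ^ 2 * m)) * S n :=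
    fun h => remainder_decay hS0 (fun n hn => by linarith [hSsucc n hn, hlarge n hn]) h
  set L := Real.log (1 / tau k) with hL
  have hLpos : 0 < L := Real.log_pos (by rw [lt_div_iff₀ hτ0]; linarith)
  have hexpL : ∀ c : ℕ, Real.exp (-(c * L)) = tau k ^ c := by
    intro c
    rw [hL, one_div, Real.log_inv, mul_neg, neg_neg, Real.exp_nat_mul, Real.exp_log hτ0]
  set m := ⌈4 / tau k ^ 2 * L⌉₊ with hm
  set s := ⌈4 * (k : ℝ) ^ 2 * Real.log k⌉₊ with hs
  have hkone : (1 : ℝ) < k := by exact_mod_cast lt_of_lt_of_le (by norm_num) hk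
  have hmpos : 0 < m := Nat.ceil_pos.2 (by positivity)
  have hspos : 0 < s := Nat.ceil_pos.2 (by have := Real.log_pos hkone; positivity)
  have hR1 : (1 : ℝ) ≤ R := by exact_mod_cast hR
  have hlogR : 0 ≤ Real.log R := Real.log_nonneg hR1
  set P := 1 / tau k ^ 2 * (3 * L + Real.log R) with hP
  have hP0 : 0 ≤ P := by positivity
  have htop : topSize k R = P + s * m := rfl
  have hsm : s * m ≤ T := by
    rw [hTfloor]
    refine Nat.le_floor ?_
    rw [htop]
    push_cast
    linarith
  have hidx : ∀ l < s, l * m < T := fun l hl =>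
    lt_of_lt_of_le (Nat.mul_lt_mul_of_pos_right hl hmpos) hsm
  have hτm : Real.exp (-(tau k ^ 2 * m)) ≤ tau k ^ 4 := by
    rw [← hexpL 4]
    refine Real.exp_le_exp.2 (neg_le_neg ?_)
    calc ((4 : ℕ) : ℝ) * L = tau k ^ 2 * (4 / tau k ^ 2 * L) := by field_simp; norm_num
      _ ≤ tau k ^ 2 * m := by gcongr; exact Nat.le_ceil _
  refine ⟨fun j => if j ∈ B then w j else 0, B, subset_rfl, fun j hj => ?_, Or.inr
    ⟨fun l => e (l * m), fun l hl l' hl' h => ?_, fun l hl => ?_, ?_⟩⟩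
  · simp only [if_neg hj, zero_pow two_ne_zero]
    exact mul_nonneg (sq_nonneg _) (Finset.sum_nonneg fun _ _ => sq_nonneg _)
  · rw [Finset.mem_coe, Finset.mem_range] at hl hl'
    have := heinj (by simpa using hidx l hl) (by simpa using hidx l' hl') h
    exact Nat.eq_of_mul_eq_mul_right hmpos this
  · simp only [if_pos (heB _ (hidx _ hl)), if_pos (heB _ (hidx l (by omega)))]
    have h1 := hsmall _ (hidx _ hl)
    have hle : l * m + m ≤ T := by
      have := (hidx _ hl).le
      rwa [add_mul, one_mul] at this
    have h2 := hdecay hle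
    have h3 := hlarge _ (hidx l (by omega))
    rw [add_mul, one_mul] at h1 ⊢
    have h4 : S (l * m + m) ≤ tau k ^ 4 * S (l * m) :=
      h2.trans (mul_le_mul_of_nonneg_right hτm (hS0 _))
    have h5 : 9 * tau k ^ 2 ≤ 1 := by nlinarith
    have h6 : (3 * |w (e (l * m + m))|) ^ 2 ≤ |w (e (l * m))| ^ 2 := by
      rw [mul_pow, sq_abs, sq_abs]
      calc 3 ^ 2 * w (e (l * m + m)) ^ 2 ≤ 3 ^ 2 * (tau k ^ 4 * S (l * m)) := by
            gcongr
            exact h1.trans h4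
        _ = 9 * tau k ^ 2 * (tau k ^ 2 * S (l * m)) := by ring
        _ ≤ 1 * w (e (l * m)) ^ 2 := by
            refine mul_le_mul h5 h3.le ?_ zero_le_one
            exact mul_nonneg (sq_nonneg _) (hS0 _)
        _ = _ := one_mul _
    exact le_of_sq_le_sq h6 (abs_nonneg _)
  · have hlast := hidx (s - 1) (by omega)
    rw [← hs]
    simp only [if_pos (heB _ hlast)]
    set a := w (e ((s - 1) * m))
    have hbig : tau k ^ 2 * S ((s - 1) * m) < a ^ 2 := hlarge _ hlast
    have ha : 0 < a ^ 2 := lt_of_le_of_lt (mul_nonneg (sq_nonneg _) (hS0 _)) hbig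
    obtain ⟨N, hN⟩ := Nat.exists_eq_add_of_le hlast.le
    have hPN : P ≤ N := by
      have h1 : topSize k R < T + 1 := by
        rw [hTfloor]
        exact Nat.lt_floor_add_one _
      have h2 : (T : ℝ) = (s * m - m : ℝ) + N := by
        have h3 : (s - 1) * m + m = s * m := by
          rw [← Nat.succ_mul, Nat.succ_eq_add_one, Nat.sub_add_cancel hspos]
        have h4 : T + m = s * m + N := by omega
        have h5 : (T : ℝ) + m = s * m + N := by exact_mod_cast h4
        linarith
      have h6 : (1 : ℝ) ≤ m := by exact_mod_cast hmpos
      rw [htop, h2] at h1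
      linarith
    have hST : S T ≤ tau k ^ 3 / R * S ((s - 1) * m) := by
      have h1 := hdecay hN.ge
      rw [← hN] at h1
      refine h1.trans (mul_le_mul_of_nonneg_right ?_ (hS0 _))
      have h2 : tau k ^ 3 / R = Real.exp (-(3 * L + Real.log R)) := by
        have h3 := hexpL 3
        push_cast at h3
        rw [neg_add, Real.exp_add, h3, Real.exp_neg, Real.exp_log (by linarith), div_eq_mul_inv]
      rw [h2]
      refine Real.exp_le_exp.2 (neg_le_neg ?_)
      calc 3 * L + Real.log R = tau k ^ 2 * P := by rw [hP]; field_simp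
        _ ≤ tau k ^ 2 * N := by gcongr
    have hl1 : ∑ j, |w j - if j ∈ B then w j else 0| = ∑ j ∈ Bᶜ, |w j| := by
      have : ∀ j, |w j - if j ∈ B then w j else 0| = if j ∈ Bᶜ then |w j| else 0 := by
        intro j
        by_cases hj : j ∈ B <;> simp [hj]
      simp_rw [this]
      rw [Finset.sum_ite_mem, Finset.univ_inter]
    rw [hl1]
    have hcs : (∑ j ∈ Bᶜ, |w j|) ^ 2 ≤ R * S T := by
      have h1 := sq_sum_le_card_mul_sum_sq (s := Bᶜ) (f := fun j => |w j|)
      simp only [sq_abs] at h1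
      have h2 : ((Bᶜ.card : ℕ) : ℝ) ≤ R := by
        have := Finset.card_le_univ Bᶜ
        rw [Fintype.card_fin] at this
        exact_mod_cast this
      have h3 : S T = ∑ j ∈ Bᶜ, w j ^ 2 := by simp only [hS, hHT]
      rw [← h3] at h1
      exact h1.trans (mul_le_mul_of_nonneg_right h2 (hS0 _))
    have hfin : (4 * (k * ∑ j ∈ Bᶜ, |w j|)) ^ 2 < |a| ^ 2 := by
      rw [sq_abs]
      calc (4 * (k * ∑ j ∈ Bᶜ, |w j|)) ^ 2 = 16 * (k : ℝ) ^ 2 * (∑ j ∈ Bᶜ, |w j|) ^ 2 := by ring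
        _ ≤ 16 * (k : ℝ) ^ 2 * (R * (tau k ^ 3 / R * S ((s - 1) * m))) := by
            gcongr
            exact hcs.trans (by gcongr)
        _ = 16 * (k : ℝ) ^ 2 * tau k * (tau k ^ 2 * S ((s - 1) * m)) := by field_simp
        _ ≤ 16 * (k : ℝ) ^ 2 * tau k * a ^ 2 := by gcongr
        _ < 1 * a ^ 2 := mul_lt_mul_of_pos_right (sq_mul_tau_lt hk) ha
        _ = a ^ 2 := one_mul _
    exact lt_of_pow_lt_pow_left₀ 2 (abs_nonneg _) hfin

/-! ### Soundness -/

theorem testMass_eq {k R : ℕ} (y : Fin k → Fin R → Bool) (b : Bool) :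
    testMass k R (y, b) = 1 / 2 * ∏ j, colMass k b (fun i => y i j) := by
  rw [testMass, prod_colMass_eq (y := fun j i => y i j)]
  congr 1
  rw [← (Equiv.piComm (fun (_ : Fin R) (_ : Fin k) => Bool)).sum_comp]
  refine Finset.sum_congr rfl fun x _ => ?_
  simp only [Equiv.piComm_apply, Function.swap]
  rw [Finset.prod_comm]

theorem passProb_halfspace {k : ℕ} (hk : 12 ^ 6 ≤ k) {R : ℕ} (w : Fin k → Fin R → ℝ) (θ : ℝ) :
    passProb k R (halfspace w θ) = 1 / 2 + (accept true w θ - accept false w θ) / 2 := by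
  have hform : ∀ y : Fin R → Fin k → Bool,
      halfspace w θ (fun i j => y j i) = decide (0 ≤ linForm w y - θ) := by
    intro y
    rw [halfspace, linForm, Finset.sum_comm]
  have hsum : ∀ b, ∑ y : Fin k → Fin R → Bool,
      (if halfspace w θ y = b then testMass k R (y, b) else 0)
      = 1 / 2 * ∑ y : Fin R → Fin k → Bool, (∏ j, colMass k b (y j)) *
        if decide (0 ≤ linForm w y - θ) = b then 1 else 0 := by
    intro b
    rw [← (Equiv.piComm (fun (_ : Fin R) (_ : Fin k) => Bool)).sum_comp, Finset.mul_sum]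
    refine Finset.sum_congr rfl fun y _ => ?_
    simp only [Equiv.piComm_apply, Function.swap, hform, testMass_eq]
    split_ifs <;> ring
  have htrue : ∑ y : Fin R → Fin k → Bool, (∏ j, colMass k true (y j)) *
      (if decide (0 ≤ linForm w y - θ) = true then 1 else 0) = accept true w θ := by
    simp only [decide_eq_true_eq, accept]
  have hfalse : ∑ y : Fin R → Fin k → Bool, (∏ j, colMass k false (y j)) *
      (if decide (0 ≤ linForm w y - θ) = false then 1 else 0) = 1 - accept false w θ := by
    conv_rhs => rw [← (prod_colMass_isProbMass hk R false).2, accept, ← Finset.sum_sub_distrib]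
    refine Finset.sum_congr rfl fun y _ => ?_
    by_cases h : 0 ≤ linForm w y - θ <;> simp only [h, decide_true, decide_false, if_true, if_false,
      Bool.true_eq_false, mul_one, mul_zero, sub_self, sub_zero]
  rw [passProb, Fintype.sum_prod_type_right]
  simp only [Fintype.sum_bool, hsum]
  rw [htrue, hfalse]
  ring

end

end DictTest

theorem mainTheorem4 :
    ∃ C : ℝ, ∀ k R : ℕ, 12 ^ 6 ≤ k → 0 < R →
      ∀ (w : Fin k → Fin R → ℝ) (θ : ℝ) (B : Fin k → Finset (Fin R)),
        (∀ i, DictTest.IsTopSet (DictTest.topSize k R) (w i) (B i)) →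
        (∀ i j, i ≠ j → Disjoint (B i) (B j)) →
        DictTest.passProb k R (DictTest.halfspace w θ) ≤ 1 / 2 + C / (k : ℝ) := by
  obtain ⟨C, hC⟩ := DictTest.accept_le_of_regular
  refine ⟨(C + 2) / 2, fun k R hk hR w θ B hB hdisj => ?_⟩
  choose u H hHB hreg htrunc using fun i => DictTest.exists_truncation hk hR (hB i)
  have h1 := hC hk u θ H (fun i j hij => (hdisj i j hij).mono (hHB i) (hHB j)) hreg
  have h2 := abs_le.1 (DictTest.abs_accept_sub_le hk true htrunc θ)
  have h3 := abs_le.1 (DictTest.abs_accept_sub_le hk false htrunc θ)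
  have h4 : (C + 2) / 2 / (k : ℝ) = (C / k + 2 * (1 / k)) / 2 := by ring
  rw [DictTest.passProb_halfspace hk, h4]
  linarith [h2.2, h3.1]
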